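/- **Theorem (V-dominated convergence of weight normalization).** Let $\sigma(s)=\max\{s,0\}$. For $u,x\in\mathbb R^d$, $u\neq 0$, put $x^{u^\perp}=x-\frac{uu^\top x}{\|u\|_2^2}$. Consider data $x_1,\dots,x_n\in\mathbb R^d$, $y\in\mathbb R^n$, and the weight-normalized two-layer network $$f(x;V,g,c)=\frac1{\sqrt m}\sum_{k=1}^m c_k\,\sigma\Big(g_k\frac{v_k^\top x}{\|v_k\|_2}\Big),$$ initialized, for some $\alpha>0$, with independent $v_k(0)\sim N(0,\alpha^2 I)$ and $c_k\sim U\{-1,1\}$, and with $g_k(0)=\|v_k(0)\|_2/\alpha$. The $c_k$ are kept fixed, and all $v_k,g_k$ are trained jointly by gradient descent with step size $\eta$ on $L=\frac12\sum_i(f(x_i)-y_i)^2$, that is, $v_k(s+1)=v_k(s)-\eta\nabla_{v_k}L(s)$ and $g_k(s+1)=g_k(s)-\eta\,\partial_{g_k}L(s)$, where, with $f_i(s)=f(x_i;V(s),g(s),c)$ and $\mathbb 1_{ik}(s)=\mathbb 1\{v_k(s)^\top x_i\ge 0\}$, $$\nabla_{v_k}L=\frac1{\sqrt m}\sum_{i=1}^n(f_i-y_i)\frac{c_kg_k}{\|v_k\|_2}\mathbb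 1_{ik}\,x_i^{v_k^\perp},\qquad \partial_{g_k}L=\frac1{\sqrt m}\sum_{j=1}^n(f_j-y_j)\frac{c_k}{\|v_k\|_2}\sigma(v_k^\top x_j).$$ Let $\mathbf f(s)=(f_1(s),\dots,f_n(s))$ and let the evolution matrix be $\Lambda(s)=\frac1{\alpha^2}\mathbf V(s)+\mathbf G(s)$, where $$\mathbf V_{ij}(s)=\frac1m\sum_{k=1}^m\Big(\frac{\alpha c_kg_k(s)}{\|v_k(s)\|_2}\Big)^2\big\langle x_i^{v_k(s)^\perp},x_j^{v_k(s)^\perp}\big\rangle\mathbb 1_{ik}(s)\mathbb 1_{jk}(s),\qquad \mathbf G_{ij}(s)=\frac1m\sum_{k=1}^m\frac{\sigma(v_k(s)^\top x_i)\,\sigma(v_k(s)^\top x_j)}{\|v_k(s)\|_2^2}.$$ Let $\mathbf V^\infty_{ij}=\mathbb E_{v\sim N(0,\alpha^2I)}\langle x_i^{v^\perp},x_j^{v^\perp}\rangle\mathbb 1\{v^\top x_i\ge0\}\mathbb 1\{v^\top x_j\ge0\}$, let $\lambda_0=\lambda_{\min}(\mathbf V^\infty)$, and let $\|\cdot\|_2$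 denote the Euclidean norm of vectors and the spectral norm of matrices. There is an absolute constant $c_0>0$, and for all constants $M,K$ there is a constant $C>0$ depending only on $M$ and $K$, such that the following holds. Let $0<\alpha\le1$, $d\ge50$, $0<\delta<1$ (and $\delta\le\frac12$ if $n=1$). Let $x_1,\dots,x_n\in\mathbb R^d$ be non-zero with $\|x_i\|_2\le1$ and pairwise non-parallel ($x_i\ne\beta x_j$ for all $i\neq j$, $\beta\in\mathbb R\setminus\{0\}$), and let $\|y\|_\infty\le M$. Suppose that $$m\ \ge\ C\,\frac{n^4\log(n/\delta)}{\lambda_0^4}\qquad\text{and}\qquad \Big(\frac m\delta\Big)^{1/d}\le K\,m^{1/5}.$$ Then with probability at least $1-\delta$ over the initialization, for every step size $0<\eta\le c_0\,\alpha^2/\|\mathbf V^\infty\|_2$ and for all iterations $s=0,1,2,\dots$: 1. $\lambda_{\min}(\Lambda(s))\ge\dfrac{\lambda_0}{2\alpha^2}$; 2. $\|\mathbf f(s)-y\|_2^2\le\Big(1-\dfrac{\eta\lambda_0}{2\alpha^2}\Big)^s\|\mathbf f(0)-y\|_2^2$. -/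

import Mathlib

open MeasureTheory ProbabilityTheory
open scoped ENNReal

noncomputable section

namespace WeightNorm

/-- Euclidean space `ℝ^d`. -/
abbrev Vec (d : ℕ) : Type := EuclideanSpace ℝ (Fin d)

/-- The ReLU activation `σ(s) = max {s, 0}`. -/
def relu (s : ℝ) : ℝ := max s 0

/-- The component `x^{u⊥} = (I - u uᵀ / ‖u‖²) x` of `x` orthogonal to `u`. -/
def perp {d : ℕ} (u x : Vec d) : Vec d := x - (inner ℝ u x / ‖u‖ ^ 2) • u

open Classical in
/-- The activation indicator `1{vᵀ x ≥ 0}`. -/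
def act {d : ℕ} (v x : Vec d) : ℝ := if 0 ≤ inner ℝ v x then 1 else 0

/-- The trained parameters: directions `v_1, …, v_m ∈ ℝ^d` and lengths `g_1, …, g_m ∈ ℝ`.
The output weights `c_1, …, c_m` stay fixed during training. -/
structure Params (m d : ℕ) where
  v : Fin m → Vec d
  g : Fin m → ℝ

/-- The weight normalized two-layer network
`f(x; V, g, c) = m^{-1/2} ∑_k c_k σ(g_k v_kᵀ x / ‖v_k‖)`. -/
def net {m d : ℕ} (c : Fin m → ℝ) (θ : Params m d) (x : Vec d) : ℝ :=
  (1 / √(m : ℝ)) * ∑ k, c k * relu (θ.g k * (inner ℝ (θ.v k) x / ‖θ.v k‖))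

/-- The vector of predictions on the data, `𝐟 = (f(x_1), …, f(x_n))`. -/
def pred {m d n : ℕ} (c : Fin m → ℝ) (x : Fin n → Vec d) (θ : Params m d) :
    EuclideanSpace ℝ (Fin n) :=
  WithLp.toLp 2 fun i => net c θ (x i)

/-- The gradient with respect to `v_k` of the loss `L = (1/2) ∑_i (f(x_i) - y_i)²`. At a kink of
the ReLU the derivative of the activation is taken to be `1`. -/
def gradV {m d n : ℕ} (c : Fin m → ℝ) (x : Fin n → Vec d) (y : EuclideanSpace ℝ (Fin n))
    (θ : Params m d) (k : Fin m) : Vec d :=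
  (1 / √(m : ℝ)) • ∑ i, ((pred c x θ i - y i) * (c k * θ.g k / ‖θ.v k‖) * act (θ.v k) (x i)) •
    perp (θ.v k) (x i)

/-- The derivative with respect to `g_k` of the loss `L = (1/2) ∑_i (f(x_i) - y_i)²`. -/
def gradG {m d n : ℕ} (c : Fin m → ℝ) (x : Fin n → Vec d) (y : EuclideanSpace ℝ (Fin n))
    (θ : Params m d) (k : Fin m) : ℝ :=
  (1 / √(m : ℝ)) * ∑ j, (pred c x θ j - y j) * (c k / ‖θ.v k‖) * relu (inner ℝ (θ.v k) (x j))

/-- One gradient descent step of step size `η`, jointly in all `v_k` and `g_k`. -/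
def gdStep {m d n : ℕ} (c : Fin m → ℝ) (x : Fin n → Vec d) (y : EuclideanSpace ℝ (Fin n))
    (η : ℝ) (θ : Params m d) : Params m d where
  v k := θ.v k - η • gradV c x y θ k
  g k := θ.g k - η * gradG c x y θ k

/-- The gradient descent iterate after `s` steps from `θ₀`. -/
def gdIter {m d n : ℕ} (c : Fin m → ℝ) (x : Fin n → Vec d) (y : EuclideanSpace ℝ (Fin n))
    (η : ℝ) (θ₀ : Params m d) (s : ℕ) : Params m d :=
  (gdStep c x y η)^[s] θ₀

/-- The `v`-orthogonal Gram matrix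
`V_ij = m⁻¹ ∑_k (α c_k g_k / ‖v_k‖)² ⟨x_i^{v_k⊥}, x_j^{v_k⊥}⟩ 1_{ik} 1_{jk}`. -/
def gramV {m d n : ℕ} (α : ℝ) (c : Fin m → ℝ) (x : Fin n → Vec d) (θ : Params m d) :
    Matrix (Fin n) (Fin n) ℝ :=
  Matrix.of fun i j => (1 / (m : ℝ)) * ∑ k, (α * c k * θ.g k / ‖θ.v k‖) ^ 2 *
    inner ℝ (perp (θ.v k) (x i)) (perp (θ.v k) (x j)) * act (θ.v k) (x i) * act (θ.v k) (x j)

/-- The `v`-aligned Gram matrix `G_ij = m⁻¹ ∑_k σ(v_kᵀ x_i) σ(v_kᵀ x_j) / ‖v_k‖²`. -/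
def gramG {m d n : ℕ} (x : Fin n → Vec d) (θ : Params m d) : Matrix (Fin n) (Fin n) ℝ :=
  Matrix.of fun i j => (1 / (m : ℝ)) * ∑ k,
    relu (inner ℝ (θ.v k) (x i)) * relu (inner ℝ (θ.v k) (x j)) / ‖θ.v k‖ ^ 2

/-- The evolution matrix `Λ = V / α² + G`. -/
def evolution {m d n : ℕ} (α : ℝ) (c : Fin m → ℝ) (x : Fin n → Vec d) (θ : Params m d) :
    Matrix (Fin n) (Fin n) ℝ :=
  (1 / α ^ 2) • gramV α c x θ + gramG x θ

/-- The isotropic Gaussian law `N(0, α² I)` on `ℝ^d`. -/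
def gaussian (d : ℕ) (α : ℝ) : Measure (Vec d) :=
  (stdGaussian (Vec d)).map fun w => α • w

/-- The uniform law on `{-1, 1}`. -/
def rademacher : Measure ℝ := (2⁻¹ : ℝ≥0∞) • (Measure.dirac (-1) + Measure.dirac 1)

/-- The law of `(v_k(0), c_k)_{k ≤ m}`: all entries independent, `v_k(0) ∼ N(0, α² I)` and
`c_k` uniform on `{-1, 1}`. -/
def initLaw (m d : ℕ) (α : ℝ) : Measure (Fin m → Vec d × ℝ) :=
  Measure.pi fun _ => (gaussian d α).prod rademacher

/-- The initial parameters `v_k(0)` and `g_k(0) = ‖v_k(0)‖ / α`. -/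
def initParams {m d : ℕ} (α : ℝ) (ω : Fin m → Vec d × ℝ) : Params m d where
  v k := (ω k).1
  g k := ‖(ω k).1‖ / α

/-- The auxiliary Gram matrix
`V^∞_ij = E_{v ∼ N(0, α² I)} ⟨x_i^{v⊥}, x_j^{v⊥}⟩ 1{vᵀ x_i ≥ 0} 1{vᵀ x_j ≥ 0}`. -/
def gramVInf {d n : ℕ} (α : ℝ) (x : Fin n → Vec d) : Matrix (Fin n) (Fin n) ℝ :=
  Matrix.of fun i j =>
    ∫ v, inner ℝ (perp v (x i)) (perp v (x j)) * act v (x i) * act v (x j) ∂(gaussian d α)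

/-- The least eigenvalue of a (symmetric) real matrix. -/
def lambdaMin {n : ℕ} (A : Matrix (Fin n) (Fin n) ℝ) : ℝ := sInf (spectrum ℝ A)

/-- The spectral norm of a real matrix. -/
def specNorm {n : ℕ} (A : Matrix (Fin n) (Fin n) ℝ) : ℝ :=
  ‖Matrix.toEuclideanCLM (n := Fin n) (𝕜 := ℝ) A‖

end WeightNorm

end

/-! The predictions depend on each `v_k` only through its direction, so writing `v_k = α w_k`
reduces the claim to `α`-free initial directions: the `w_k` start standard Gaussian and move with
step `h = η / α²`, the lengths move with step `h α²`, and the evolution matrix becomes `α⁻² (V + α²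
G)` (`gdStep_scale`, `evolution_scale`).

The deterministic half is `GoodInit.descent`. As long as every `w_k` and `g_k` is within `R` of its
initial value, `V` stays entrywise within `12 τ` of `V^∞`, where `τ = λ₀ / (100 n)`, so `V + α² G ≥
0.88 λ₀`. One step changes the predictions by the linear term given by this matrix, up to an error
`0.12 h λ₀ ‖f - y‖`. The residual thus contracts by at least `1 - h λ₀ / 2`, the displacements sum
as a geometric series, and the radius `R ~ n √L / (√m λ₀)`, with `L = log (n/δ)`, is never exceeded.
Since the gradient in `w_k` is orthogonal to `w_k`, norms never decrease, and lower bounds on the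
initial norms hold for all time.

The step size must beat the largest eigenvalue of `V + α² G`. The part `G` is bounded by its trace,
about `∑ ‖x_i‖² / d`, and this is at most `8 ‖V^∞‖` because `V^∞` dominates one eighth of the Gram
matrix of the data (`norm_sum_sq_le_inner_op_gramVInf`, `sum_norm_sq_le_specNorm`).

The probabilistic half is `baseLaw_not_good_le`. Hoeffding bounds control `V(0) - V^∞`, the trace of
`G(0)`, the fraction of neurons near a kink and the average of `R / ‖w_k‖`; random signs make the
initial predictions sub-Gaussian. A Gaussian small-ball bound and a union bound give `‖w_k‖ > 4 R`
for all `k`, which is where `(m/δ)^(1/d) ≤ K m^(1/5)` enters (`small_ball_budget`). Finally `λ₀ > 0`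
follows from non-parallel data (`lambdaMin_gramVInf_pos`). -/

noncomputable section
namespace WeightNorm

/-! ### Perturbation estimates for a single neuron. -/

section Neuron
variable {d : ℕ}

lemma inner_perp_left (u x z : Vec d) :
    inner ℝ (perp u x) z = inner ℝ x z - inner ℝ u x / ‖u‖ * (inner ℝ u z / ‖u‖) := by
  simp only [perp, inner_sub_left, real_inner_smul_left]
  ring

lemma inner_perp_self (u x : Vec d) : inner ℝ (perp u x) u = 0 := by
  rw [inner_perp_left, real_inner_self_eq_norm_sq, real_inner_comm u x]
  rcases eq_or_ne u 0 with rfl | hu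
  · simp
  · have := norm_pos_iff.2 hu
    field_simp
    ring

lemma inner_perp_perp (u x z : Vec d) :
    inner ℝ (perp u x) (perp u z) = inner ℝ (perp u x) z := by
  conv_lhs => rw [show perp u z = z - (inner ℝ u z / ‖u‖ ^ 2) • u from rfl]
  rw [inner_sub_right, real_inner_smul_right, inner_perp_self]
  ring

lemma inner_perp_perp_eq (u x z : Vec d) :
    inner ℝ (perp u x) (perp u z) =
      inner ℝ x z - inner ℝ u x / ‖u‖ * (inner ℝ u z / ‖u‖) := by
  rw [inner_perp_perp, inner_perp_left]

lemma norm_perp_le (u x : Vec d) : ‖perp u x‖ ≤ ‖x‖ := by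
  refine (sq_le_sq₀ (norm_nonneg _) (norm_nonneg _)).1 ?_
  rw [← real_inner_self_eq_norm_sq, ← real_inner_self_eq_norm_sq, inner_perp_perp_eq]
  nlinarith [sq_nonneg (inner ℝ u x / ‖u‖)]

lemma perp_smul {t : ℝ} (ht : t ≠ 0) (u x : Vec d) : perp (t • u) x = perp u x := by
  simp only [perp, real_inner_smul_left, norm_smul, mul_pow, smul_smul, Real.norm_eq_abs, sq_abs]
  congr 2
  rcases eq_or_ne ‖u‖ 0 with hu | hu
  · simp [hu]
  · field_simp

lemma perp_add (u x z : Vec d) : perp u (x + z) = perp u x + perp u z := by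
  simp only [perp, inner_add_right, add_div, add_smul]
  abel

lemma perp_smul_right (u x : Vec d) (t : ℝ) : perp u (t • x) = t • perp u x := by
  simp only [perp, real_inner_smul_right, smul_sub, smul_smul, mul_div_assoc]

lemma perp_sum {ι : Type*} (s : Finset ι) (u : Vec d) (f : ι → Vec d) :
    perp u (∑ i ∈ s, f i) = ∑ i ∈ s, perp u (f i) := by
  simp only [perp, inner_sum, Finset.sum_div, Finset.sum_smul, Finset.sum_sub_distrib]

lemma act_smul {t : ℝ} (ht : 0 < t) (u x : Vec d) : act (t • u) x = act u x := by
  simp only [act, real_inner_smul_left, mul_nonneg_iff_of_pos_left ht]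

lemma act_nonneg (u x : Vec d) : 0 ≤ act u x := by
  unfold act; split_ifs <;> norm_num

lemma act_le_one (u x : Vec d) : act u x ≤ 1 := by
  unfold act; split_ifs <;> norm_num

lemma abs_act_le_one (u x : Vec d) : |act u x| ≤ 1 :=
  abs_le.2 ⟨by linarith [act_nonneg u x], act_le_one u x⟩

lemma relu_nonneg (t : ℝ) : 0 ≤ relu t := le_max_right _ _

lemma abs_relu_sub_le (s t : ℝ) : |relu s - relu t| ≤ |s - t| :=
  abs_max_sub_max_le_abs s t 0

lemma abs_relu_le (s : ℝ) : |relu s| ≤ |s| := by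
  simpa [relu] using abs_relu_sub_le s 0

lemma relu_mul {a : ℝ} (ha : 0 ≤ a) (s : ℝ) : relu (a * s) = a * relu s := by
  simp [relu, mul_max_of_nonneg _ _ ha]

lemma relu_div {a : ℝ} (ha : 0 ≤ a) (s : ℝ) : relu (s / a) = relu s / a := by
  rw [div_eq_inv_mul, relu_mul (inv_nonneg.2 ha), div_eq_inv_mul]

lemma abs_inner_div_norm_le (u x : Vec d) : |inner ℝ u x / ‖u‖| ≤ ‖x‖ := by
  rw [abs_div, abs_norm]
  refine div_le_of_le_mul₀ (norm_nonneg _) (norm_nonneg _) ?_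
  rw [mul_comm]
  exact abs_real_inner_le_norm u x

lemma relu_inner_div_norm_le (u x : Vec d) : relu (inner ℝ u x) / ‖u‖ ≤ ‖x‖ := by
  rw [← relu_div (norm_nonneg _)]
  exact (le_abs_self _).trans ((abs_relu_le _).trans (abs_inner_div_norm_le u x))

/-- Normalized inner products are stable under a perturbation which does not shorten the
direction. -/
lemma abs_inner_div_norm_sub_le {w w₀ : Vec d} {R : ℝ} (h0 : 0 < ‖w₀‖) (hle : ‖w₀‖ ≤ ‖w‖)
    (hR : ‖w - w₀‖ ≤ R) {x : Vec d} (hx : ‖x‖ ≤ 1) :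
    |inner ℝ w x / ‖w‖ - inner ℝ w₀ x / ‖w₀‖| ≤ 2 * (R / ‖w₀‖) := by
  have hw : 0 < ‖w‖ := h0.trans_le hle
  have hxn := norm_nonneg x
  have hR0 : 0 ≤ R := (norm_nonneg _).trans hR
  have h1 : |inner ℝ (w - w₀) x| ≤ R :=
    (abs_real_inner_le_norm _ _).trans (by nlinarith [norm_nonneg (w - w₀)])
  have h2 : |‖w‖ - ‖w₀‖| ≤ R := (abs_norm_sub_norm_le w w₀).trans hR
  have key : inner ℝ w x / ‖w‖ - inner ℝ w₀ x / ‖w₀‖ =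
      (inner ℝ (w - w₀) x - inner ℝ w x / ‖w‖ * (‖w‖ - ‖w₀‖)) / ‖w₀‖ := by
    rw [inner_sub_left]
    field_simp
    ring
  rw [key, abs_div, abs_norm, mul_div_assoc']
  gcongr
  have h3 : |inner ℝ w x / ‖w‖ * (‖w‖ - ‖w₀‖)| ≤ 1 * R := by
    rw [abs_mul]
    exact mul_le_mul ((abs_inner_div_norm_le w x).trans hx) h2 (abs_nonneg _) zero_le_one
  calc _ ≤ |inner ℝ (w - w₀) x| + |inner ℝ w x / ‖w‖ * (‖w‖ - ‖w₀‖)| := abs_sub _ _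
    _ ≤ 2 * R := by linarith

lemma abs_mul_sub_mul_le {a b a' b' e : ℝ} (hb : |b| ≤ 1) (ha' : |a'| ≤ 1)
    (h1 : |a - a'| ≤ e) (h2 : |b - b'| ≤ e) : |a * b - a' * b'| ≤ 2 * e := by
  have : a * b - a' * b' = (a - a') * b + a' * (b - b') := by ring
  rw [this]
  refine (abs_add_le _ _).trans ?_
  rw [abs_mul, abs_mul]
  nlinarith [abs_nonneg (a - a'), abs_nonneg (b - b'), abs_nonneg b, abs_nonneg a']

lemma abs_inner_perp_sub_le {w w₀ : Vec d} {R : ℝ} (h0 : 0 < ‖w₀‖) (hle : ‖w₀‖ ≤ ‖w‖)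
    (hR : ‖w - w₀‖ ≤ R) {x z : Vec d} (hx : ‖x‖ ≤ 1) (hz : ‖z‖ ≤ 1) :
    |inner ℝ (perp w x) (perp w z) - inner ℝ (perp w₀ x) (perp w₀ z)| ≤ 4 * (R / ‖w₀‖) := by
  rw [inner_perp_perp_eq, inner_perp_perp_eq]
  have := abs_mul_sub_mul_le ((abs_inner_div_norm_le w z).trans hz)
    ((abs_inner_div_norm_le w₀ x).trans hx) (abs_inner_div_norm_sub_le h0 hle hR hx)
    (abs_inner_div_norm_sub_le h0 hle hR hz)
  rw [← abs_neg]
  calc _ = |inner ℝ w x / ‖w‖ * (inner ℝ w z / ‖w‖) -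
        inner ℝ w₀ x / ‖w₀‖ * (inner ℝ w₀ z / ‖w₀‖)| := by congr 1; ring
    _ ≤ _ := by linarith

lemma abs_inner_perp_le (w : Vec d) {x z : Vec d} (hx : ‖x‖ ≤ 1) (hz : ‖z‖ ≤ 1) :
    |inner ℝ (perp w x) (perp w z)| ≤ 1 := by
  refine (abs_real_inner_le_norm _ _).trans ?_
  have h1 := (norm_perp_le w x).trans hx
  have h2 := (norm_perp_le w z).trans hz
  nlinarith [norm_nonneg (perp w x), norm_nonneg (perp w z)]

open Classical in
/-- The indicator that the preactivation `⟨w₀, x⟩` may change sign within distance `R`. -/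
def nearKink (R : ℝ) (w₀ x : Vec d) : ℝ := if |inner ℝ w₀ x| ≤ R * ‖x‖ then 1 else 0

lemma nearKink_nonneg (R : ℝ) (w₀ x : Vec d) : 0 ≤ nearKink R w₀ x := by
  unfold nearKink; split_ifs <;> norm_num

lemma nearKink_le_one (R : ℝ) (w₀ x : Vec d) : nearKink R w₀ x ≤ 1 := by
  unfold nearKink; split_ifs <;> norm_num

/-- A displacement of size `R` moves the preactivation by at most `R ‖x‖`, so only neurons counted
by `nearKink` can change activation. -/
lemma inner_mul_pos_of_not_nearKink {R : ℝ} {w w₀ x : Vec d} (hR : ‖w - w₀‖ ≤ R)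
    (h : ¬ |inner ℝ w₀ x| ≤ R * ‖x‖) :
    (0 < inner ℝ w x ∧ 0 < inner ℝ w₀ x) ∨ (inner ℝ w x < 0 ∧ inner ℝ w₀ x < 0) := by
  have h1 : |inner ℝ (w - w₀) x| ≤ R * ‖x‖ :=
    (abs_real_inner_le_norm _ _).trans (by gcongr)
  rw [inner_sub_left] at h1
  have h1' := abs_le.1 h1
  rcases lt_abs.1 (not_le.1 h) with h | h
  · left; constructor <;> nlinarith [norm_nonneg x, norm_nonneg (w - w₀)]
  · right; constructor <;> nlinarith [norm_nonneg x, norm_nonneg (w - w₀)]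

lemma abs_act_sub_le {R : ℝ} {w w₀ x : Vec d} (hR : ‖w - w₀‖ ≤ R) :
    |act w x - act w₀ x| ≤ nearKink R w₀ x := by
  unfold nearKink
  split_ifs with h
  · exact abs_le.2 ⟨by linarith [act_nonneg w x, act_le_one w₀ x],
      by linarith [act_nonneg w₀ x, act_le_one w x]⟩
  · rcases inner_mul_pos_of_not_nearKink hR h with ⟨h1, h2⟩ | ⟨h1, h2⟩
    · simp [act, h1.le, h2.le]
    · simp [act, not_le.2 h1, not_le.2 h2]

/-- The ReLU is affine between two points whose preactivations have the same sign. -/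
lemma abs_relu_sub_sub_act_le {R : ℝ} {w w' w₀ x : Vec d} (hR : ‖w - w₀‖ ≤ R)
    (hR' : ‖w' - w₀‖ ≤ R) (hx : ‖x‖ ≤ 1) :
    |relu (inner ℝ w' x) - relu (inner ℝ w x) - act w x * inner ℝ (w' - w) x| ≤
      ‖w' - w‖ * nearKink R w₀ x := by
  unfold nearKink
  split_ifs with h
  -- Near the kink the linearization error is no larger than the change of the preactivation itself.
  · have h1 : |inner ℝ (w' - w) x| ≤ ‖w' - w‖ :=
      (abs_real_inner_le_norm _ _).trans (mul_le_of_le_one_right (norm_nonneg _) hx)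
    rw [mul_one]
    refine le_trans ?_ h1
    rw [inner_sub_left]
    unfold act relu
    generalize inner ℝ w' x = a
    generalize inner ℝ w x = b
    split_ifs with hb
    · rcases le_total 0 a with ha | ha
      · simp [ha, hb]
      · rw [max_eq_right ha, max_eq_left hb, abs_of_nonpos (by linarith : a - b ≤ 0),
          abs_of_nonneg (by linarith)]
        linarith
    · rw [max_eq_right (le_of_not_ge hb), abs_of_nonneg (by simp)]
      rcases le_total 0 a with ha | ha
      · rw [max_eq_left ha]
        linarith [le_abs_self (a - b), not_le.1 hb]
      · rw [max_eq_right ha]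
        simp
  · rw [inner_sub_left]
    rcases inner_mul_pos_of_not_nearKink hR h with ⟨h1, h2⟩ | ⟨h1, h2⟩ <;>
    rcases inner_mul_pos_of_not_nearKink hR' h with ⟨h3, h4⟩ | ⟨h3, h4⟩ <;>
    first
      | linarith
      | simp [act, relu, h1.le, h3.le, not_le.2 h1]

/-- Stability of one summand of the `v`-orthogonal Gram matrix. -/
lemma abs_gramV_term_sub_le {w w₀ x z : Vec d} {R ρ : ℝ} (h4 : 4 * R ≤ ‖w₀‖) (h0 : 0 < ‖w₀‖)
    (hle : ‖w₀‖ ≤ ‖w‖) (hR : ‖w - w₀‖ ≤ R) (hρ : |ρ - 1| ≤ 2 * (R / ‖w₀‖))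
    (hx : ‖x‖ ≤ 1) (hz : ‖z‖ ≤ 1) :
    |ρ ^ 2 * inner ℝ (perp w x) (perp w z) * act w x * act w z -
      inner ℝ (perp w₀ x) (perp w₀ z) * act w₀ x * act w₀ z| ≤
      9 * (R / ‖w₀‖) + nearKink R w₀ x + nearKink R w₀ z := by
  have hR0 : 0 ≤ R := (norm_nonneg _).trans hR
  set q := R / ‖w₀‖ with hq
  have hq0 : 0 ≤ q := by positivity
  have hq4 : q ≤ 1 / 4 := by rw [hq, div_le_iff₀ h0]; linarith
  have e1 := abs_inner_perp_sub_le h0 hle hR hx hz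
  have b1 := abs_inner_perp_le w hx hz
  have b2 := abs_inner_perp_le w₀ hx hz
  have a1 := abs_act_sub_le (x := x) hR
  have a2 := abs_act_sub_le (x := z) hR
  have c1 := abs_act_le_one w x
  have c2 := abs_act_le_one w z
  have c3 := abs_act_le_one w₀ x
  generalize inner ℝ (perp w x) (perp w z) = p at *
  generalize inner ℝ (perp w₀ x) (perp w₀ z) = p₀ at *
  generalize act w x = s at *
  generalize act w z = t at *
  generalize act w₀ x = s₀ at *
  generalize act w₀ z = t₀ at *
  -- `|ρ - 1| ≤ 2 q` and `|ρ + 1| ≤ 5/2`, the latter because `q ≤ 1/4`. Together with the `4 q` from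
  -- the inner products this makes up the `9 q` of the claim.
  have hρ2 : |ρ ^ 2 - 1| ≤ 5 * q := by
    have h : ρ ^ 2 - 1 = (ρ - 1) * ((ρ - 1) + 2) := by ring
    have h' : |(ρ - 1) + 2| ≤ 5 / 2 := by
      refine (abs_add_le _ _).trans ?_
      rw [abs_two]; linarith
    rw [h, abs_mul]
    nlinarith [abs_nonneg (ρ - 1), abs_nonneg (ρ - 1 + 2)]
  have key : ρ ^ 2 * p * s * t - p₀ * s₀ * t₀ =
      (ρ ^ 2 - 1) * (p * s * t) + (p - p₀) * (s * t) + p₀ * t * (s - s₀) +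
        p₀ * s₀ * (t - t₀) := by ring
  have m1 : ∀ {a b : ℝ}, |a| ≤ 1 → |b| ≤ 1 → |a * b| ≤ 1 := fun {a b} ha hb => by
    rw [abs_mul]; exact mul_le_one₀ ha (abs_nonneg _) hb
  have m2 : ∀ {a b e : ℝ}, |a| ≤ e → |b| ≤ 1 → |a * b| ≤ e := fun {a b e} ha hb => by
    rw [abs_mul]; exact (mul_le_of_le_one_right (abs_nonneg _) hb).trans ha
  have m3 : ∀ {a b e : ℝ}, |a| ≤ 1 → |b| ≤ e → |a * b| ≤ e := fun {a b e} ha hb => by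
    rw [mul_comm]; exact m2 hb ha
  rw [key]
  refine (abs_add_le _ _).trans ?_
  refine (add_le_add (abs_add_le _ _) le_rfl).trans ?_
  refine (add_le_add (add_le_add (abs_add_le _ _) le_rfl) le_rfl).trans ?_
  have := m2 hρ2 (m1 (m1 b1 c1) c2)
  have := m2 e1 (m1 c1 c2)
  have := m3 (m1 b2 c2) a1
  have := m3 (m1 b2 c3) a2
  linarith

/-- The length-to-norm ratio stays close to its initial value `1`. -/
lemma abs_ratio_sub_one_le {w w₀ : Vec d} {R g : ℝ} (h0 : 0 < ‖w₀‖)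
    (hle : ‖w₀‖ ≤ ‖w‖) (hR : ‖w - w₀‖ ≤ R) (hg : |g - ‖w₀‖| ≤ R) :
    |g / ‖w‖ - 1| ≤ 2 * (R / ‖w₀‖) := by
  have hw : 0 < ‖w‖ := h0.trans_le hle
  have h2 : |‖w‖ - ‖w₀‖| ≤ R := (abs_norm_sub_norm_le w w₀).trans hR
  have h3 : |g - ‖w‖| ≤ 2 * R := by
    rw [abs_le] at *
    constructor <;> linarith [h2.1, h2.2, hg.1, hg.2]
  have : g / ‖w‖ - 1 = (g - ‖w‖) / ‖w‖ := by field_simp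
  rw [this, abs_div, abs_norm, mul_div_assoc']
  have : 0 ≤ R := (abs_nonneg _).trans hg
  gcongr

/-- Second order remainder of one neuron under an update with `Δw ⊥ w`. -/
lemma abs_neuron_remainder_le {w w' w₀ x : Vec d} {R H g g' : ℝ} (h4 : 4 * R ≤ ‖w₀‖)
    (h0 : 0 < ‖w₀‖) (hle : ‖w₀‖ ≤ ‖w‖) (hle' : ‖w‖ ≤ ‖w'‖) (hR : ‖w - w₀‖ ≤ R)
    (hR' : ‖w' - w₀‖ ≤ R) (hg : |g - ‖w₀‖| ≤ R) (hg' : |g' - ‖w₀‖| ≤ R)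
    (hpyth : ‖w'‖ ^ 2 = ‖w‖ ^ 2 + ‖w' - w‖ ^ 2) (hH : ‖w' - w‖ ≤ 2 * H) (hH' : |g' - g| ≤ H)
    (hx : ‖x‖ ≤ 1) :
    |relu (g' * (inner ℝ w' x / ‖w'‖)) - relu (g * (inner ℝ w x / ‖w‖)) -
      (g / ‖w‖ * act w x * inner ℝ (w' - w) x + (g' - g) * (relu (inner ℝ w x) / ‖w‖))| ≤
      H * (4 * nearKink R w₀ x + 8 * (R / ‖w₀‖)) := by
  have hw : 0 < ‖w‖ := h0.trans_le hle
  have hw' : 0 < ‖w'‖ := hw.trans_le hle'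
  have hR0 : 0 ≤ R := (norm_nonneg _).trans hR
  have hH0 : 0 ≤ H := (abs_nonneg _).trans hH'
  have hg0 : 0 ≤ g := by linarith [(abs_le.1 hg).1]
  have hg0' : 0 ≤ g' := by linarith [(abs_le.1 hg').1]
  rw [relu_mul hg0, relu_mul hg0', relu_div hw.le, relu_div hw'.le]
  have hflip := abs_relu_sub_sub_act_le hR hR' hx
  have hdd : ‖w' - w‖ ≤ 2 * R := by
    calc ‖w' - w‖ = ‖(w' - w₀) - (w - w₀)‖ := by congr 1; abel
      _ ≤ _ := norm_sub_le _ _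
      _ ≤ _ := by linarith
  have hrel : |relu (inner ℝ w' x) - relu (inner ℝ w x)| ≤ ‖w' - w‖ := by
    refine (abs_relu_sub_le _ _).trans ?_
    rw [← inner_sub_left]
    exact (abs_real_inner_le_norm _ _).trans (mul_le_of_le_one_right (norm_nonneg _) hx)
  have hs' : relu (inner ℝ w' x) / ‖w'‖ ≤ 1 := (relu_inner_div_norm_le w' x).trans hx
  have hs'0 : 0 ≤ relu (inner ℝ w' x) / ‖w'‖ := div_nonneg (relu_nonneg _) hw'.le
  have hrat : g / ‖w‖ ≤ 2 := by
    rw [div_le_iff₀ hw]; linarith [(abs_le.1 hg).2]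
  have hrat' : g' / ‖w‖ ≤ 2 := by
    rw [div_le_iff₀ hw]; linarith [(abs_le.1 hg').2]
  -- The growth of the norm is of second order: by Pythagoras `(‖w'‖ - ‖w‖)(‖w'‖ + ‖w‖) = ‖w' -
  -- w‖²`. One factor is bounded by `2 H` and the other by `2 R`.
  have hnn : ‖w'‖ - ‖w‖ ≤ 2 * H * (R / ‖w₀‖) := by
    have h1 : (‖w'‖ - ‖w‖) * (2 * ‖w₀‖) ≤ 2 * H * (2 * R) := by
      calc (‖w'‖ - ‖w‖) * (2 * ‖w₀‖) ≤ (‖w'‖ - ‖w‖) * (‖w'‖ + ‖w‖) := by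
            apply mul_le_mul_of_nonneg_left _ (by linarith); linarith
        _ = ‖w' - w‖ * ‖w' - w‖ := by nlinarith
        _ ≤ _ := mul_le_mul hH hdd (norm_nonneg _) (by linarith)
    rw [mul_div_assoc', le_div_iff₀ h0]
    linarith
  set K := nearKink R w₀ x
  have hK0 : 0 ≤ K := nearKink_nonneg _ _ _
  set a := relu (inner ℝ w' x)
  set b := relu (inner ℝ w x)
  set A := act w x * inner ℝ (w' - w) x
  -- The remainder splits into the kink error, the mixed increment of length and direction, and the
  -- change of the normalization.
  have key : g' * (a / ‖w'‖) - g * (b / ‖w‖) - (g / ‖w‖ * act w x * inner ℝ (w' - w) x +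
      (g' - g) * (b / ‖w‖)) =
      g / ‖w‖ * (a - b - A) + (g' - g) * ((a - b) / ‖w‖) -
        g' / ‖w‖ * (a / ‖w'‖) * (‖w'‖ - ‖w‖) := by
    simp only [A]
    field_simp
    ring
  rw [key]
  refine (abs_sub _ _).trans ?_
  refine (add_le_add (abs_add_le _ _) le_rfl).trans ?_
  have t1 : |g / ‖w‖ * (a - b - A)| ≤ 2 * (2 * H * K) := by
    rw [abs_mul, abs_of_nonneg (by positivity)]
    refine mul_le_mul hrat (hflip.trans ?_) (abs_nonneg _) zero_le_two
    gcongr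
  have t2 : |(g' - g) * ((a - b) / ‖w‖)| ≤ H * (2 * (R / ‖w₀‖)) := by
    rw [abs_mul]
    refine mul_le_mul hH' ?_ (abs_nonneg _) hH0
    rw [abs_div, abs_norm, mul_div_assoc']
    have := hrel.trans hdd
    gcongr
  have t3 : |g' / ‖w‖ * (a / ‖w'‖) * (‖w'‖ - ‖w‖)| ≤ 2 * (2 * H * (R / ‖w₀‖)) := by
    rw [abs_of_nonneg (mul_nonneg (by positivity) (by linarith))]
    refine mul_le_mul ?_ hnn (by linarith) zero_le_two
    calc _ ≤ g' / ‖w‖ * 1 := by gcongr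
      _ ≤ 2 := by linarith
  have : 0 ≤ H * (R / ‖w₀‖) := by positivity
  nlinarith

end Neuron
-- Quadratic forms, least eigenvalue and spectral norm.
section QuadraticForms
variable {n : ℕ}

/-- The continuous linear operator on `ℝ^n` given by a matrix. -/
abbrev op (A : Matrix (Fin n) (Fin n) ℝ) :
    EuclideanSpace ℝ (Fin n) →L[ℝ] EuclideanSpace ℝ (Fin n) :=
  Matrix.toEuclideanCLM (n := Fin n) (𝕜 := ℝ) A

lemma op_apply (A : Matrix (Fin n) (Fin n) ℝ) (a : EuclideanSpace ℝ (Fin n)) (i : Fin n) :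
    op A a i = ∑ j, A i j * a j := by
  simp [op, Matrix.mulVec, dotProduct]

lemma inner_op (A : Matrix (Fin n) (Fin n) ℝ) (a b : EuclideanSpace ℝ (Fin n)) :
    inner ℝ a (op A b) = ∑ i, ∑ j, a i * A i j * b j := by
  simp only [PiLp.inner_apply, op_apply, RCLike.inner_apply, conj_trivial, Finset.sum_mul]
  exact Finset.sum_congr rfl fun i _ => Finset.sum_congr rfl fun j _ => by ring

lemma sum_abs_le_sqrt_mul_norm (a : EuclideanSpace ℝ (Fin n)) :
    ∑ i, |a i| ≤ √(n : ℝ) * ‖a‖ := by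
  have h : (∑ i, |a i|) ^ 2 ≤ (n : ℝ) * ‖a‖ ^ 2 := by
    have := sq_sum_le_card_mul_sum_sq (s := Finset.univ) (f := fun i => |a i|)
    simpa [EuclideanSpace.norm_sq_eq] using this
  rw [← Real.sqrt_sq (norm_nonneg a), ← Real.sqrt_mul (by positivity)]
  exact Real.le_sqrt_of_sq_le h

lemma norm_le_sqrt_mul_of_forall_abs_le {a : EuclideanSpace ℝ (Fin n)} {e : ℝ} (he : 0 ≤ e)
    (h : ∀ i, |a i| ≤ e) : ‖a‖ ≤ √(n : ℝ) * e := by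
  rw [EuclideanSpace.norm_eq, ← Real.sqrt_sq he, ← Real.sqrt_mul (by positivity)]
  refine Real.sqrt_le_sqrt ?_
  calc ∑ i, ‖a i‖ ^ 2 ≤ ∑ _i : Fin n, e ^ 2 :=
        Finset.sum_le_sum fun i _ => pow_le_pow_left₀ (norm_nonneg _) (h i) 2
    _ = n * e ^ 2 := by simp

/-- Entrywise control costs a factor `n` in the quadratic form, which is why `τ` is later chosen as
`λ₀ / (100 n)`. -/
lemma abs_inner_op_le {A : Matrix (Fin n) (Fin n) ℝ} {e : ℝ} (he : 0 ≤ e)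
    (h : ∀ i j, |A i j| ≤ e) (a : EuclideanSpace ℝ (Fin n)) :
    |inner ℝ a (op A a)| ≤ n * e * ‖a‖ ^ 2 := by
  rw [inner_op]
  calc |∑ i, ∑ j, a i * A i j * a j| ≤ ∑ i, ∑ j, |a i| * e * |a j| := by
        refine (Finset.abs_sum_le_sum_abs _ _).trans (Finset.sum_le_sum fun i _ => ?_)
        refine (Finset.abs_sum_le_sum_abs _ _).trans (Finset.sum_le_sum fun j _ => ?_)
        rw [abs_mul, abs_mul]
        gcongr
        exact h i j
    _ = e * (∑ i, |a i|) ^ 2 := by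
        rw [sq, Finset.sum_mul_sum, Finset.mul_sum]
        refine Finset.sum_congr rfl fun i _ => ?_
        rw [Finset.mul_sum]
        exact Finset.sum_congr rfl fun j _ => by ring
    _ ≤ e * (√(n : ℝ) * ‖a‖) ^ 2 := by
        gcongr
        exact sum_abs_le_sqrt_mul_norm a
    _ = _ := by rw [mul_pow, Real.sq_sqrt (by positivity)]; ring

lemma inner_op_sub (A B : Matrix (Fin n) (Fin n) ℝ) (a b : EuclideanSpace ℝ (Fin n)) :
    inner ℝ a (op (A - B) b) = inner ℝ a (op A b) - inner ℝ a (op B b) := by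
  simp [op, inner_sub_right]

lemma inner_op_add (A B : Matrix (Fin n) (Fin n) ℝ) (a b : EuclideanSpace ℝ (Fin n)) :
    inner ℝ a (op (A + B) b) = inner ℝ a (op A b) + inner ℝ a (op B b) := by
  simp [op, inner_add_right]

lemma inner_op_smul (t : ℝ) (A : Matrix (Fin n) (Fin n) ℝ) (a b : EuclideanSpace ℝ (Fin n)) :
    inner ℝ a (op (t • A) b) = t * inner ℝ a (op A b) := by
  simp [op, inner_smul_right]

lemma inner_op_comm {A : Matrix (Fin n) (Fin n) ℝ} (hA : ∀ i j, A i j = A j i)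
    (a b : EuclideanSpace ℝ (Fin n)) : inner ℝ a (op A b) = inner ℝ b (op A a) := by
  rw [inner_op, inner_op, Finset.sum_comm]
  exact Finset.sum_congr rfl fun i _ => Finset.sum_congr rfl fun j _ => by rw [hA j i]; ring

/-- A symmetric operator between `0` and `q` has norm at most `q`. -/
lemma norm_le_of_symm_of_bounds {F : Type*} [NormedAddCommGroup F] [InnerProductSpace ℝ F]
    (T : F →L[ℝ] F) (hsymm : ∀ a b, inner ℝ a (T b) = inner ℝ b (T a)) {q : ℝ} (hq : 0 < q)
    (h0 : ∀ a, 0 ≤ inner ℝ a (T a)) (h1 : ∀ a, inner ℝ a (T a) ≤ q * ‖a‖ ^ 2) (a : F) :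
    ‖T a‖ ≤ q * ‖a‖ := by
  refine (sq_le_sq₀ (norm_nonneg _) (by positivity)).1 ?_
  -- Positivity at `q a - T a` reads `q² T - 2 q T² + T³ ≥ 0` as a form at `a`. Since `T³ ≤ q T²`,
  -- it follows that `q T² ≤ q² T ≤ q³`, without diagonalizing `T`.
  have h := h0 (q • a - T a)
  have e : inner ℝ (q • a - T a) (T (q • a - T a)) =
      q ^ 2 * inner ℝ a (T a) - 2 * q * ‖T a‖ ^ 2 + inner ℝ (T a) (T (T a)) := by
    simp only [map_sub, map_smul, inner_sub_left, inner_sub_right, real_inner_smul_left,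
      real_inner_smul_right, real_inner_self_eq_norm_sq]
    rw [hsymm a (T a), real_inner_self_eq_norm_sq]
    ring
  rw [e] at h
  have h2 := h1 a
  have h3 := h1 (T a)
  have h5 : q * ‖T a‖ ^ 2 ≤ q * (q * ‖a‖) ^ 2 := by nlinarith [mul_le_mul_of_nonneg_left h2 (sq_nonneg q)]
  exact le_of_mul_le_mul_left h5 hq

/-- Contraction of a gradient step with a symmetric matrix whose spectrum lies in `[μ, h⁻¹]`. -/
lemma norm_sub_smul_op_le {A : Matrix (Fin n) (Fin n) ℝ} (hA : ∀ i j, A i j = A j i)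
    {h μ S : ℝ} (hh : 0 < h) (hS : h * S ≤ 1) (hμ : h * μ < 1)
    (hlow : ∀ a, μ * ‖a‖ ^ 2 ≤ inner ℝ a (op A a))
    (hup : ∀ a, inner ℝ a (op A a) ≤ S * ‖a‖ ^ 2) (a : EuclideanSpace ℝ (Fin n)) :
    ‖a - h • op A a‖ ≤ (1 - h * μ) * ‖a‖ := by
  have := norm_le_of_symm_of_bounds (ContinuousLinearMap.id ℝ _ - h • op A)
    (q := 1 - h * μ) ?_ (by linarith) ?_ ?_ a
  · simpa using this
  · intro a b
    simp only [sub_apply, smul_apply,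
      ContinuousLinearMap.id_apply, inner_sub_right, real_inner_smul_right]
    rw [inner_op_comm hA a b, real_inner_comm]
  · intro a
    simp only [sub_apply, smul_apply,
      ContinuousLinearMap.id_apply, inner_sub_right, real_inner_smul_right,
      real_inner_self_eq_norm_sq]
    nlinarith [mul_le_mul_of_nonneg_left (hup a) hh.le, sq_nonneg ‖a‖]
  · intro a
    simp only [sub_apply, smul_apply,
      ContinuousLinearMap.id_apply, inner_sub_right, real_inner_smul_right,
      real_inner_self_eq_norm_sq]
    nlinarith [mul_le_mul_of_nonneg_left (hlow a) hh.le]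

lemma exists_eigenvector_lambdaMin (hn : 0 < n) {A : Matrix (Fin n) (Fin n) ℝ}
    (hA : ∀ i j, A i j = A j i) :
    ∃ a : EuclideanSpace ℝ (Fin n), ‖a‖ = 1 ∧ op A a = lambdaMin A • a := by
  have hH : A.IsHermitian := Matrix.IsHermitian.ext fun i j => by simpa using hA j i
  have : Nonempty (Fin n) := ⟨⟨0, hn⟩⟩
  have hs : spectrum ℝ A = Set.range hH.eigenvalues := hH.spectrum_real_eq_range_eigenvalues
  have hmem : lambdaMin A ∈ spectrum ℝ A := by
    unfold lambdaMin
    rw [hs]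
    exact (Set.range_nonempty _).csInf_mem (Set.finite_range _)
  rw [hs] at hmem
  obtain ⟨i, hi⟩ := hmem
  refine ⟨hH.eigenvectorBasis i, hH.eigenvectorBasis.orthonormal.1 i, ?_⟩
  have := hH.mulVec_eigenvectorBasis i
  rw [hi] at this
  ext j
  have := congrFun this j
  simpa [op] using this

lemma lambdaMin_mul_le {A : Matrix (Fin n) (Fin n) ℝ}
    (hA : ∀ i j, A i j = A j i) (a : EuclideanSpace ℝ (Fin n)) :
    lambdaMin A * ‖a‖ ^ 2 ≤ inner ℝ a (op A a) := by
  have hH : A.IsHermitian := Matrix.IsHermitian.ext fun i j => by simpa using hA j i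
  have hs : spectrum ℝ A = Set.range hH.eigenvalues := hH.spectrum_real_eq_range_eigenvalues
  have hle : ∀ i, lambdaMin A ≤ hH.eigenvalues i := fun i =>
    csInf_le (by rw [hs]; exact (Set.finite_range _).bddBelow) (by rw [hs]; exact ⟨i, rfl⟩)
  set b := hH.eigenvectorBasis
  have hb : ∀ i, op A (b i) = hH.eigenvalues i • b i := fun i => by
    have := hH.mulVec_eigenvectorBasis i
    ext j
    have := congrFun this j
    simpa [op] using this
  have e1 : inner ℝ a (op A a) = ∑ i, hH.eigenvalues i * (inner ℝ (b i) a) ^ 2 := by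
    rw [← b.sum_inner_mul_inner]
    refine Finset.sum_congr rfl fun i _ => ?_
    rw [inner_op_comm hA, hb, inner_smul_right, real_inner_comm a (b i)]
    ring
  have e2 : ‖a‖ ^ 2 = ∑ i, (inner ℝ (b i) a) ^ 2 := by
    rw [← real_inner_self_eq_norm_sq, ← b.sum_inner_mul_inner]
    refine Finset.sum_congr rfl fun i _ => ?_
    rw [real_inner_comm a (b i)]
    ring
  rw [e1, e2, Finset.mul_sum]
  exact Finset.sum_le_sum fun i _ => mul_le_mul_of_nonneg_right (hle i) (sq_nonneg _)

lemma le_lambdaMin (hn : 0 < n) {A : Matrix (Fin n) (Fin n) ℝ}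
    (hA : ∀ i j, A i j = A j i) {t : ℝ}
    (h : ∀ a : EuclideanSpace ℝ (Fin n), t * ‖a‖ ^ 2 ≤ inner ℝ a (op A a)) : t ≤ lambdaMin A := by
  obtain ⟨a, ha, he⟩ := exists_eigenvector_lambdaMin hn hA
  have := h a
  rw [he, real_inner_smul_right, real_inner_self_eq_norm_sq, ha] at this
  linarith

lemma inner_op_le_specNorm (A : Matrix (Fin n) (Fin n) ℝ) (a : EuclideanSpace ℝ (Fin n)) :
    inner ℝ a (op A a) ≤ specNorm A * ‖a‖ ^ 2 := by
  calc _ ≤ ‖a‖ * ‖op A a‖ := real_inner_le_norm _ _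
    _ ≤ ‖a‖ * (‖op A‖ * ‖a‖) := by gcongr; exact (op A).le_opNorm a
    _ = _ := by unfold specNorm; ring

lemma lambdaMin_le_specNorm (hn : 0 < n) {A : Matrix (Fin n) (Fin n) ℝ}
    (hA : ∀ i j, A i j = A j i) : lambdaMin A ≤ specNorm A := by
  obtain ⟨a, ha, -⟩ := exists_eigenvector_lambdaMin hn hA
  have h1 := lambdaMin_mul_le hA a
  have h2 := inner_op_le_specNorm A a
  rw [ha] at h1 h2
  linarith

lemma lambdaMin_le_diag {A : Matrix (Fin n) (Fin n) ℝ}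
    (hA : ∀ i j, A i j = A j i) (i : Fin n) : lambdaMin A ≤ A i i := by
  have h := lambdaMin_mul_le hA (EuclideanSpace.single i 1)
  rw [inner_op] at h
  simpa [Finset.sum_ite_eq, Pi.single_apply] using h

end QuadraticForms

/-! ### Symmetry of the Gram matrices and the trace bound for `G`. -/

section Gram
variable {m d n : ℕ}

lemma gramV_symm (α : ℝ) (c : Fin m → ℝ) (x : Fin n → Vec d) (θ : Params m d) (i j : Fin n) :
    gramV α c x θ i j = gramV α c x θ j i := by
  simp only [gramV, Matrix.of_apply]
  congr 1
  refine Finset.sum_congr rfl fun k _ => ?_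
  rw [real_inner_comm]
  ring

lemma gramG_symm (x : Fin n → Vec d) (θ : Params m d) (i j : Fin n) :
    gramG x θ i j = gramG x θ j i := by
  simp only [gramG, Matrix.of_apply]
  congr 1
  exact Finset.sum_congr rfl fun k _ => by ring

lemma gramG_eq (x : Fin n → Vec d) (θ : Params m d) (i j : Fin n) :
    gramG x θ i j = (1 / (m : ℝ)) * ∑ k, relu (inner ℝ (θ.v k) (x i)) / ‖θ.v k‖ *
      (relu (inner ℝ (θ.v k) (x j)) / ‖θ.v k‖) := by
  simp only [gramG, Matrix.of_apply]
  congr 1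
  exact Finset.sum_congr rfl fun k _ => by ring

lemma inner_op_gramG (x : Fin n → Vec d) (θ : Params m d) (a : EuclideanSpace ℝ (Fin n)) :
    inner ℝ a (op (gramG x θ) a) =
      (1 / (m : ℝ)) * ∑ k, (∑ i, a i * (relu (inner ℝ (θ.v k) (x i)) / ‖θ.v k‖)) ^ 2 := by
  rw [inner_op]
  simp only [gramG_eq, sq, Finset.sum_mul_sum]
  rw [Finset.mul_sum]
  simp only [Finset.mul_sum, Finset.sum_mul]
  rw [Finset.sum_comm' (t' := Finset.univ) (s' := fun _ => Finset.univ) (by simp)]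
  conv_rhs => rw [Finset.sum_comm]
  conv_lhs => rw [Finset.sum_comm]
  refine Finset.sum_congr rfl fun i _ => ?_
  rw [Finset.sum_comm]
  exact Finset.sum_congr rfl fun k _ => Finset.sum_congr rfl fun j _ => by ring

lemma inner_op_gramG_nonneg (x : Fin n → Vec d) (θ : Params m d)
    (a : EuclideanSpace ℝ (Fin n)) : 0 ≤ inner ℝ a (op (gramG x θ) a) := by
  rw [inner_op_gramG]
  positivity

/-- A positive semidefinite matrix is bounded by its trace; here this is Cauchy–Schwarz in each
neuron. -/
lemma inner_op_gramG_le (x : Fin n → Vec d) (θ : Params m d) (a : EuclideanSpace ℝ (Fin n)) :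
    inner ℝ a (op (gramG x θ) a) ≤ (∑ i, gramG x θ i i) * ‖a‖ ^ 2 := by
  rw [inner_op_gramG]
  have : (∑ i, gramG x θ i i) * ‖a‖ ^ 2 = (1 / (m : ℝ)) * ∑ k, (∑ i, a i ^ 2) *
      ∑ i, (relu (inner ℝ (θ.v k) (x i)) / ‖θ.v k‖) ^ 2 := by
    simp only [gramG_eq, EuclideanSpace.norm_sq_eq, Real.norm_eq_abs, sq_abs]
    rw [← Finset.mul_sum, ← Finset.mul_sum, Finset.sum_comm]
    simp only [sq]
    ring
  rw [this]
  gcongr with k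
  exact Finset.sum_mul_sq_le_sq_mul_sq _ _ _

end Gram
-- Deterministic convergence from a good initialization.
section Descent
variable {m d n : ℕ}

/-- Gradient descent with step size `h` for the directions and `h * β` for the lengths. -/
def scaledStep (c : Fin m → ℝ) (x : Fin n → Vec d) (y : EuclideanSpace ℝ (Fin n))
    (β h : ℝ) (θ : Params m d) : Params m d where
  v k := θ.v k - h • gradV c x y θ k
  g k := θ.g k - h * β * gradG c x y θ k

/-- The parameters `θ` stay within distance `R` of the initialization with directions `w₀` and
lengths `‖w₀ k‖`, and no direction has become shorter. -/
structure NearInit (w₀ : Fin m → Vec d) (R : ℝ) (θ : Params m d) : Prop where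
  v_close : ∀ k, ‖θ.v k - w₀ k‖ ≤ R
  g_close : ∀ k, |θ.g k - ‖w₀ k‖| ≤ R
  norm_le : ∀ k, ‖w₀ k‖ ≤ ‖θ.v k‖

/-- The deterministic properties of the initialization used in the convergence proof. -/
structure GoodInit (x : Fin n → Vec d) (c : Fin m → ℝ) (w₀ : Fin m → Vec d)
    (W : Matrix (Fin n) (Fin n) ℝ) (R τ T : ℝ) : Prop where
  m_pos : 0 < m
  x_le : ∀ i, ‖x i‖ ≤ 1
  c_sq : ∀ k, c k ^ 2 = 1
  w_pos : ∀ k, 0 < ‖w₀ k‖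
  four_le : ∀ k, 4 * R ≤ ‖w₀ k‖
  inv_le : (1 / (m : ℝ)) * ∑ k, R / ‖w₀ k‖ ≤ τ
  kink_le : ∀ i, (1 / (m : ℝ)) * ∑ k, nearKink R (w₀ k) (x i) ≤ τ
  gram_le : ∀ i j, |gramV 1 c x ⟨w₀, fun k => ‖w₀ k‖⟩ i j - W i j| ≤ τ
  trace_le : ∑ i, gramG x ⟨w₀, fun k => ‖w₀ k‖⟩ i i ≤ T

variable {x : Fin n → Vec d} {c : Fin m → ℝ} {w₀ : Fin m → Vec d}
  {W : Matrix (Fin n) (Fin n) ℝ} {R τ T : ℝ}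

lemma abs_avg_sub_avg_le {a b e : Fin m → ℝ} (h : ∀ k, |a k - b k| ≤ e k) :
    |(1 / (m : ℝ)) * ∑ k, a k - (1 / (m : ℝ)) * ∑ k, b k| ≤ (1 / (m : ℝ)) * ∑ k, e k := by
  rw [← mul_sub, ← Finset.sum_sub_distrib, abs_mul, abs_of_nonneg (by positivity)]
  gcongr
  exact (Finset.abs_sum_le_sum_abs _ _).trans (Finset.sum_le_sum fun k _ => h k)

lemma gramV_one_apply (hc : ∀ k, c k ^ 2 = 1) (θ : Params m d) (i j : Fin n) :
    gramV 1 c x θ i j = (1 / (m : ℝ)) * ∑ k, (θ.g k / ‖θ.v k‖) ^ 2 *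
      inner ℝ (perp (θ.v k) (x i)) (perp (θ.v k) (x j)) * act (θ.v k) (x i) *
        act (θ.v k) (x j) := by
  simp only [gramV, Matrix.of_apply]
  congr 1
  refine Finset.sum_congr rfl fun k _ => ?_
  rw [one_mul, mul_div_assoc, mul_pow, hc k, one_mul]

lemma gramV_init_apply (hc : ∀ k, c k ^ 2 = 1) (h0 : ∀ k, 0 < ‖w₀ k‖) (i j : Fin n) :
    gramV 1 c x ⟨w₀, fun k => ‖w₀ k‖⟩ i j = (1 / (m : ℝ)) * ∑ k,
      inner ℝ (perp (w₀ k) (x i)) (perp (w₀ k) (x j)) * act (w₀ k) (x i) * act (w₀ k) (x j) := by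
  rw [gramV_one_apply hc]
  congr 1
  refine Finset.sum_congr rfl fun k _ => ?_
  rw [div_self (h0 k).ne', one_pow, one_mul]

/-- Movement from the initialization costs `9 τ` on average through `R / ‖w₀ k‖` and `τ` for each of
the two activations; the initial deviation from `W` adds another `τ`. -/
lemma GoodInit.abs_gramV_sub_le (hI : GoodInit x c w₀ W R τ T) {θ : Params m d}
    (hθ : NearInit w₀ R θ) (i j : Fin n) : |gramV 1 c x θ i j - W i j| ≤ 12 * τ := by
  have h : |gramV 1 c x θ i j - gramV 1 c x ⟨w₀, fun k => ‖w₀ k‖⟩ i j| ≤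
      (1 / (m : ℝ)) * ∑ k, (9 * (R / ‖w₀ k‖) + nearKink R (w₀ k) (x i) +
        nearKink R (w₀ k) (x j)) := by
    rw [gramV_one_apply hI.c_sq, gramV_init_apply hI.c_sq hI.w_pos]
    refine abs_avg_sub_avg_le fun k => ?_
    exact abs_gramV_term_sub_le (hI.four_le k) (hI.w_pos k) (hθ.norm_le k) (hθ.v_close k)
      (abs_ratio_sub_one_le (hI.w_pos k) (hθ.norm_le k) (hθ.v_close k) (hθ.g_close k))
      (hI.x_le i) (hI.x_le j)
  rw [Finset.sum_add_distrib, Finset.sum_add_distrib, ← Finset.mul_sum] at h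
  have h1 := hI.inv_le
  have h2 := hI.kink_le i
  have h3 := hI.kink_le j
  have h4 := hI.gram_le i j
  calc _ = |(gramV 1 c x θ i j - gramV 1 c x ⟨w₀, fun k => ‖w₀ k‖⟩ i j) +
        (gramV 1 c x ⟨w₀, fun k => ‖w₀ k‖⟩ i j - W i j)| := by congr 1; ring
    _ ≤ _ := abs_add_le _ _
    _ ≤ _ := by linarith

lemma GoodInit.trace_gramG_le (hI : GoodInit x c w₀ W R τ T) {θ : Params m d}
    (hθ : NearInit w₀ R θ) : ∑ i, gramG x θ i i ≤ T + n * (4 * τ) := by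
  have h : ∀ i, gramG x θ i i ≤ gramG x ⟨w₀, fun k => ‖w₀ k‖⟩ i i + 4 * τ := fun i => by
    have h1 : |gramG x θ i i - gramG x ⟨w₀, fun k => ‖w₀ k‖⟩ i i| ≤
        (1 / (m : ℝ)) * ∑ k, 4 * (R / ‖w₀ k‖) := by
      rw [gramG_eq, gramG_eq]
      refine abs_avg_sub_avg_le fun k => ?_
      have hb : ∀ w : Vec d, |relu (inner ℝ w (x i)) / ‖w‖| ≤ 1 := fun w => by
        rw [abs_of_nonneg (div_nonneg (relu_nonneg _) (norm_nonneg _))]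
        exact (relu_inner_div_norm_le _ _).trans (hI.x_le i)
      have hd : |relu (inner ℝ (θ.v k) (x i)) / ‖θ.v k‖ -
          relu (inner ℝ (w₀ k) (x i)) / ‖w₀ k‖| ≤ 2 * (R / ‖w₀ k‖) := by
        rw [← relu_div (norm_nonneg _), ← relu_div (norm_nonneg _)]
        exact (abs_relu_sub_le _ _).trans
          (abs_inner_div_norm_sub_le (hI.w_pos k) (hθ.norm_le k) (hθ.v_close k) (hI.x_le i))
      have := abs_mul_sub_mul_le (hb (θ.v k)) (hb (w₀ k)) hd hd
      linarith
    rw [← Finset.mul_sum] at h1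
    have := hI.inv_le
    linarith [(abs_le.1 h1).2]
  calc _ ≤ ∑ i, (gramG x ⟨w₀, fun k => ‖w₀ k‖⟩ i i + 4 * τ) := Finset.sum_le_sum fun i _ => h i
    _ ≤ _ := by
      rw [Finset.sum_add_distrib]
      simpa using hI.trace_le

variable {lam S β : ℝ}

/-- `G` is positive semidefinite and can be dropped; the loss `12 n τ` is at most `12/100` of `lam`,
leaving `22/25`. -/
lemma GoodInit.le_evolution (hI : GoodInit x c w₀ W R τ T) {θ : Params m d}
    (hθ : NearInit w₀ R θ) (hτ : 100 * (n * τ) ≤ lam) (hτ0 : 0 ≤ τ) (hβ : 0 ≤ β)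
    (hlow : ∀ a, lam * ‖a‖ ^ 2 ≤ inner ℝ a (op W a)) (a : EuclideanSpace ℝ (Fin n)) :
    22 / 25 * lam * ‖a‖ ^ 2 ≤ inner ℝ a (op (gramV 1 c x θ + β • gramG x θ) a) := by
  have h1 := abs_inner_op_le (A := gramV 1 c x θ - W) (e := 12 * τ) (by linarith)
    (fun i j => hI.abs_gramV_sub_le hθ i j) a
  rw [inner_op_sub] at h1
  rw [inner_op_add, inner_op_smul]
  have h2 := mul_nonneg hβ (inner_op_gramG_nonneg x θ a)
  have h3 := mul_le_mul_of_nonneg_right hτ (sq_nonneg ‖a‖)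
  linarith [(abs_le.1 h1).1, hlow a]

lemma GoodInit.evolution_le (hI : GoodInit x c w₀ W R τ T) {θ : Params m d}
    (hθ : NearInit w₀ R θ) (hτ : 100 * (n * τ) ≤ lam) (hτ0 : 0 ≤ τ) (hβ1 : β ≤ 1)
    (hup : ∀ a, inner ℝ a (op W a) ≤ S * ‖a‖ ^ 2) (a : EuclideanSpace ℝ (Fin n)) :
    inner ℝ a (op (gramV 1 c x θ + β • gramG x θ) a) ≤ (S + T + lam) * ‖a‖ ^ 2 := by
  have h1 := abs_inner_op_le (A := gramV 1 c x θ - W) (e := 12 * τ) (by linarith)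
    (fun i j => hI.abs_gramV_sub_le hθ i j) a
  rw [inner_op_sub] at h1
  rw [inner_op_add, inner_op_smul]
  have h2 := mul_le_of_le_one_left (inner_op_gramG_nonneg x θ a) hβ1
  have h3 := inner_op_gramG_le x θ a
  have h4 := mul_le_mul_of_nonneg_right (hI.trace_gramG_le hθ) (sq_nonneg ‖a‖)
  have h5 := mul_le_mul_of_nonneg_right hτ (sq_nonneg ‖a‖)
  have h6 : 0 ≤ n * τ * ‖a‖ ^ 2 := by positivity
  linarith [(abs_le.1 h1).2, hup a]

/-- This orthogonality, caused by the normalization, makes gradient steps lengthen the directions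
(`norm_scaledStep_sq`). -/
lemma inner_gradV_eq_zero (y : EuclideanSpace ℝ (Fin n)) (θ : Params m d) (k : Fin m) :
    inner ℝ (θ.v k) (gradV c x y θ k) = 0 := by
  simp only [gradV, inner_smul_right, inner_sum]
  rw [Finset.sum_eq_zero, mul_zero]
  intro i _
  rw [real_inner_comm, inner_perp_self, mul_zero]

lemma GoodInit.ratio_le (hI : GoodInit x c w₀ W R τ T) {θ : Params m d}
    (hθ : NearInit w₀ R θ) (k : Fin m) : |c k * θ.g k / ‖θ.v k‖| ≤ 2 := by
  have hw : 0 < ‖θ.v k‖ := (hI.w_pos k).trans_le (hθ.norm_le k)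
  have hR : 0 ≤ R := (norm_nonneg _).trans (hθ.v_close k)
  have hc : |c k| = 1 := by
    rw [← sq_eq_sq₀ (abs_nonneg _) zero_le_one, sq_abs, hI.c_sq k, one_pow]
  rw [abs_div, abs_mul, hc, abs_norm, div_le_iff₀ hw, one_mul, abs_le]
  have h1 := abs_le.1 (hθ.g_close k)
  have h2 := hI.four_le k
  have h3 := hθ.norm_le k
  constructor <;> linarith [h1.1, h1.2]

lemma GoodInit.norm_gradV_le (hI : GoodInit x c w₀ W R τ T) {θ : Params m d}
    (hθ : NearInit w₀ R θ) (y : EuclideanSpace ℝ (Fin n)) (k : Fin m) :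
    ‖gradV c x y θ k‖ ≤ 2 * (1 / √(m : ℝ) * (√(n : ℝ) * ‖pred c x θ - y‖)) := by
  unfold gradV
  rw [norm_smul, Real.norm_of_nonneg (by positivity), mul_left_comm]
  gcongr
  calc _ ≤ ∑ i, 2 * |(pred c x θ - y) i| := by
        refine (norm_sum_le _ _).trans (Finset.sum_le_sum fun i _ => ?_)
        rw [norm_smul, Real.norm_eq_abs, abs_mul, abs_mul]
        have h1 := hI.ratio_le hθ k
        have h2 := abs_act_le_one (θ.v k) (x i)
        have h3 := (norm_perp_le (θ.v k) (x i)).trans (hI.x_le i)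
        calc _ ≤ |pred c x θ i - y i| * 2 * 1 * 1 := by gcongr
          _ = _ := by simp [mul_comm]
    _ = 2 * ∑ i, |(pred c x θ - y) i| := by rw [Finset.mul_sum]
    _ ≤ _ := by gcongr; exact sum_abs_le_sqrt_mul_norm _

lemma GoodInit.abs_gradG_le (hI : GoodInit x c w₀ W R τ T)
    (y : EuclideanSpace ℝ (Fin n)) (θ : Params m d) (k : Fin m) :
    |gradG c x y θ k| ≤ 1 / √(m : ℝ) * (√(n : ℝ) * ‖pred c x θ - y‖) := by
  unfold gradG
  rw [abs_mul, abs_of_nonneg (by positivity : (0 : ℝ) ≤ 1 / √(m : ℝ))]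
  have hc : |c k| = 1 := by
    rw [← sq_eq_sq₀ (abs_nonneg _) zero_le_one, sq_abs, hI.c_sq k, one_pow]
  gcongr
  calc _ ≤ ∑ i, |(pred c x θ - y) i| := by
        refine (Finset.abs_sum_le_sum_abs _ _).trans (Finset.sum_le_sum fun i _ => ?_)
        have h1 := (relu_inner_div_norm_le (θ.v k) (x i)).trans (hI.x_le i)
        rw [mul_assoc, div_mul_eq_mul_div, mul_div_assoc, abs_mul, abs_mul, hc, one_mul,
          abs_of_nonneg (div_nonneg (relu_nonneg _) (norm_nonneg _))]
        exact mul_le_of_le_one_right (abs_nonneg _) h1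
    _ ≤ _ := sum_abs_le_sqrt_mul_norm _

/-- The first order change of the predictions under a gradient step. -/
lemma first_order_eq (hc : ∀ k, c k ^ 2 = 1) (y : EuclideanSpace ℝ (Fin n)) (β h : ℝ)
    (θ : Params m d) (i : Fin n) :
    (1 / √(m : ℝ)) * ∑ k, c k * (θ.g k / ‖θ.v k‖ * act (θ.v k) (x i) *
        inner ℝ (-(h • gradV c x y θ k)) (x i) +
        -(h * β * gradG c x y θ k) * (relu (inner ℝ (θ.v k) (x i)) / ‖θ.v k‖)) =
      -(h * op (gramV 1 c x θ + β • gramG x θ) (pred c x θ - y) i) := by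
  have hm : (1 / √(m : ℝ)) * (1 / √(m : ℝ)) = 1 / m := by
    rw [div_mul_div_comm, Real.mul_self_sqrt (by positivity), one_mul]
  have e1 : ∀ k, c k * (θ.g k / ‖θ.v k‖ * act (θ.v k) (x i) *
        inner ℝ (-(h • gradV c x y θ k)) (x i) +
        -(h * β * gradG c x y θ k) * (relu (inner ℝ (θ.v k) (x i)) / ‖θ.v k‖)) =
      -h * (1 / √(m : ℝ)) * ∑ j, ((θ.g k / ‖θ.v k‖) ^ 2 *
        inner ℝ (perp (θ.v k) (x i)) (perp (θ.v k) (x j)) * act (θ.v k) (x i) *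
        act (θ.v k) (x j) + β * (relu (inner ℝ (θ.v k) (x i)) / ‖θ.v k‖ *
      (relu (inner ℝ (θ.v k) (x j)) / ‖θ.v k‖))) * (pred c x θ - y) j := by
    intro k
    have h2 := hc k
    simp only [gradV, gradG, inner_neg_left, real_inner_smul_left, sum_inner]
    have e2 : ∀ j, inner ℝ (perp (θ.v k) (x j)) (x i) =
        inner ℝ (perp (θ.v k) (x i)) (perp (θ.v k) (x j)) := fun j => by
      rw [← inner_perp_perp, real_inner_comm]
    simp only [e2]
    simp only [Finset.mul_sum, Finset.sum_mul, mul_add, ← Finset.sum_neg_distrib,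
      ← Finset.sum_add_distrib, PiLp.sub_apply]
    -- The two sides differ only by the factor `c k ^ 2 = 1`, so the output signs disappear from the
    -- evolution matrix.
    refine Finset.sum_congr rfl fun j _ => ?_
    linear_combination (-h * (1 / √(m : ℝ)) * (((θ.g k / ‖θ.v k‖) ^ 2 *
        inner ℝ (perp (θ.v k) (x i)) (perp (θ.v k) (x j)) * act (θ.v k) (x i) *
        act (θ.v k) (x j) + β * (relu (inner ℝ (θ.v k) (x i)) / ‖θ.v k‖ *
      (relu (inner ℝ (θ.v k) (x j)) / ‖θ.v k‖))) * (pred c x θ j - y j))) * h2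
  simp only [e1]
  rw [op_apply]
  simp only [Matrix.add_apply, Matrix.smul_apply, gramV_one_apply hc, gramG_eq, smul_eq_mul]
  rw [← Finset.mul_sum, Finset.sum_comm, mul_left_comm, ← mul_assoc,
    show -h * (1 / √(m : ℝ)) * (1 / √(m : ℝ)) = -h * (1 / m) by rw [← hm]; ring,
    mul_assoc, neg_mul, Finset.mul_sum]
  congr 2
  refine Finset.sum_congr rfl fun j _ => ?_
  rw [← Finset.sum_mul, Finset.sum_add_distrib, ← Finset.mul_sum]
  ring

lemma norm_scaledStep_sq (y : EuclideanSpace ℝ (Fin n)) (h : ℝ) (θ : Params m d) (k : Fin m) :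
    ‖(scaledStep c x y β h θ).v k‖ ^ 2 =
      ‖θ.v k‖ ^ 2 + ‖(scaledStep c x y β h θ).v k - θ.v k‖ ^ 2 := by
  simp only [scaledStep, sub_sub_cancel_left, norm_neg]
  rw [norm_sub_sq_real, inner_smul_right, inner_gradV_eq_zero]
  ring

lemma norm_le_norm_scaledStep (y : EuclideanSpace ℝ (Fin n)) (h : ℝ) (θ : Params m d)
    (k : Fin m) : ‖θ.v k‖ ≤ ‖(scaledStep c x y β h θ).v k‖ := by
  rw [← sq_le_sq₀ (norm_nonneg _) (norm_nonneg _), norm_scaledStep_sq]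
  linarith [sq_nonneg ‖(scaledStep c x y β h θ).v k - θ.v k‖]

/-- The predictions follow the linearized dynamics up to an error controlled by `τ`. -/
lemma GoodInit.norm_linearization_le (hI : GoodInit x c w₀ W R τ T)
    {y : EuclideanSpace ℝ (Fin n)} {h : ℝ} {θ : Params m d} (hτ0 : 0 ≤ τ) (hh : 0 < h)
    (hβ0 : 0 ≤ β) (hβ1 : β ≤ 1) (hθ : NearInit w₀ R θ)
    (hθ' : NearInit w₀ R (scaledStep c x y β h θ)) :
    ‖pred c x (scaledStep c x y β h θ) - pred c x θ +
      h • op (gramV 1 c x θ + β • gramG x θ) (pred c x θ - y)‖ ≤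
      h * (12 * (n * τ)) * ‖pred c x θ - y‖ := by
  set θ' := scaledStep c x y β h θ with hθ'def
  set r := pred c x θ - y
  set H := h * (1 / √(m : ℝ) * (√(n : ℝ) * ‖r‖)) with hHdef
  have hH0 : 0 ≤ H := by positivity
  have hm0 : (0 : ℝ) < m := by exact_mod_cast hI.m_pos
  have hv : ∀ k, θ'.v k - θ.v k = -(h • gradV c x y θ k) := fun k => by
    simp [hθ'def, scaledStep]
  have hg : ∀ k, θ'.g k - θ.g k = -(h * β * gradG c x y θ k) := fun k => by
    simp [hθ'def, scaledStep]
  have hvH : ∀ k, ‖θ'.v k - θ.v k‖ ≤ 2 * H := fun k => by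
    rw [hv, norm_neg, norm_smul, Real.norm_of_nonneg hh.le, hHdef]
    have := mul_le_mul_of_nonneg_left (hI.norm_gradV_le hθ y k) hh.le
    linarith
  have hgH : ∀ k, |θ'.g k - θ.g k| ≤ H := fun k => by
    rw [hg, abs_neg, abs_mul, abs_of_nonneg (by positivity), hHdef]
    calc _ ≤ h * 1 * (1 / √(m : ℝ) * (√(n : ℝ) * ‖r‖)) := by
          gcongr
          exact hI.abs_gradG_le y θ k
      _ = _ := by ring
  -- In each neuron the first order terms cancel exactly by `first_order_eq`. The averaged
  -- remainders give `4 τ` from the kinks and `8 τ` from `R / ‖w₀ k‖`.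
  have hentry : ∀ i, |(pred c x θ' - pred c x θ +
      h • op (gramV 1 c x θ + β • gramG x θ) r) i| ≤ h * √(n : ℝ) * ‖r‖ * (12 * τ) := by
    intro i
    have hfo := first_order_eq (x := x) hI.c_sq y β h θ i
    have e : (pred c x θ' - pred c x θ + h • op (gramV 1 c x θ + β • gramG x θ) r) i =
        (1 / √(m : ℝ)) * ∑ k, c k * (relu (θ'.g k * (inner ℝ (θ'.v k) (x i) / ‖θ'.v k‖)) -
          relu (θ.g k * (inner ℝ (θ.v k) (x i) / ‖θ.v k‖)) -
          (θ.g k / ‖θ.v k‖ * act (θ.v k) (x i) * inner ℝ (θ'.v k - θ.v k) (x i) +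
          (θ'.g k - θ.g k) * (relu (inner ℝ (θ.v k) (x i)) / ‖θ.v k‖))) := by
      simp only [hv, hg]
      simp only [mul_sub, Finset.sum_sub_distrib]
      rw [hfo]
      simp only [PiLp.add_apply, PiLp.sub_apply, PiLp.smul_apply, smul_eq_mul]
      rw [sub_neg_eq_add]
      rfl
    rw [e, abs_mul, abs_of_nonneg (by positivity : (0 : ℝ) ≤ 1 / √(m : ℝ))]
    calc _ ≤ 1 / √(m : ℝ) * ∑ k, H * (4 * nearKink R (w₀ k) (x i) + 8 * (R / ‖w₀ k‖)) := by
          gcongr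
          refine (Finset.abs_sum_le_sum_abs _ _).trans (Finset.sum_le_sum fun k _ => ?_)
          have hc : |c k| = 1 := by
            rw [← sq_eq_sq₀ (abs_nonneg _) zero_le_one, sq_abs, hI.c_sq k, one_pow]
          rw [abs_mul, hc, one_mul]
          exact abs_neuron_remainder_le (hI.four_le k) (hI.w_pos k) (hθ.norm_le k)
            (norm_le_norm_scaledStep y h θ k) (hθ.v_close k) (hθ'.v_close k) (hθ.g_close k)
            (hθ'.g_close k) (norm_scaledStep_sq y h θ k) (hvH k) (hgH k) (hI.x_le i)
      _ = h * √(n : ℝ) * ‖r‖ * (4 * ((1 / (m : ℝ)) * ∑ k, nearKink R (w₀ k) (x i)) +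
            8 * ((1 / (m : ℝ)) * ∑ k, R / ‖w₀ k‖)) := by
          rw [← Finset.mul_sum, Finset.sum_add_distrib, ← Finset.mul_sum, ← Finset.mul_sum, hHdef]
          have hm : (1 / √(m : ℝ)) * (1 / √(m : ℝ)) = 1 / m := by
            rw [div_mul_div_comm, Real.mul_self_sqrt (by positivity), one_mul]
          rw [← hm]
          ring
      _ ≤ _ := by
          gcongr
          linarith [hI.kink_le i, hI.inv_le]
  refine (norm_le_sqrt_mul_of_forall_abs_le (by positivity) hentry).trans (le_of_eq ?_)
  rw [show √(n : ℝ) * (h * √(n : ℝ) * ‖r‖ * (12 * τ)) =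
    √(n : ℝ) * √(n : ℝ) * (h * ‖r‖ * (12 * τ)) by ring, Real.mul_self_sqrt (by positivity)]
  ring

/-- The linear part contracts by `1 - 0.88 h lam` and the linearization error adds at most `0.12 h
lam`, so even `1 - 0.76 h lam` would be available. -/
lemma GoodInit.norm_residual_step_le (hI : GoodInit x c w₀ W R τ T)
    {y : EuclideanSpace ℝ (Fin n)} {h : ℝ} {θ : Params m d} (hτ : 100 * (n * τ) ≤ lam)
    (hτ0 : 0 ≤ τ) (hlam : 0 < lam) (hlamS : lam ≤ S) (hT : 0 ≤ T) (hh : 0 < h)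
    (hβ0 : 0 ≤ β) (hβ1 : β ≤ 1)
    (hlow : ∀ a, lam * ‖a‖ ^ 2 ≤ inner ℝ a (op W a))
    (hup : ∀ a, inner ℝ a (op W a) ≤ S * ‖a‖ ^ 2)
    (hstep : h * (S + T + lam) ≤ 1) (hθ : NearInit w₀ R θ)
    (hθ' : NearInit w₀ R (scaledStep c x y β h θ)) :
    ‖pred c x (scaledStep c x y β h θ) - y‖ ≤ (1 - h * lam / 2) * ‖pred c x θ - y‖ := by
  set r := pred c x θ - y
  have hsym : ∀ i j, (gramV 1 c x θ + β • gramG x θ) i j =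
      (gramV 1 c x θ + β • gramG x θ) j i := fun i j => by
    rw [Matrix.add_apply, Matrix.add_apply, Matrix.smul_apply, Matrix.smul_apply,
      gramV_symm, gramG_symm]
  have hμ : h * (22 / 25 * lam) < 1 := by nlinarith [mul_pos hh hlam, mul_nonneg hh.le hT]
  have h1 := norm_sub_smul_op_le hsym hh hstep hμ (hI.le_evolution hθ hτ hτ0 hβ0 hlow)
    (hI.evolution_le hθ hτ hτ0 hβ1 hup) r
  have h2 := hI.norm_linearization_le hτ0 hh hβ0 hβ1 hθ hθ'
  have e : pred c x (scaledStep c x y β h θ) - y =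
      (r - h • op (gramV 1 c x θ + β • gramG x θ) r) +
      (pred c x (scaledStep c x y β h θ) - pred c x θ +
      h • op (gramV 1 c x θ + β • gramG x θ) r) := by
    simp only [r]; abel
  rw [e]
  refine (norm_add_le _ _).trans ((add_le_add h1 h2).trans ?_)
  have h3 : h * (12 * (n * τ)) ≤ h * (12 / 100 * lam) :=
    mul_le_mul_of_nonneg_left (by linarith) hh.le
  have h4 := mul_le_mul_of_nonneg_right h3 (norm_nonneg r)
  have h5 := mul_nonneg (mul_pos hh hlam).le (norm_nonneg r)
  change (1 - h * (22 / 25 * lam)) * ‖r‖ + h * (12 * (n * τ)) * ‖r‖ ≤ _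
  linarith

/-- Convergence of gradient descent from a good initialization. -/
theorem GoodInit.descent (hI : GoodInit x c w₀ W R τ T)
    {y : EuclideanSpace ℝ (Fin n)} {h : ℝ} (hτ : 100 * (n * τ) ≤ lam)
    (hτ0 : 0 ≤ τ) (hlam : 0 < lam) (hlamS : lam ≤ S) (hT : 0 ≤ T) (hh : 0 < h)
    (hβ0 : 0 ≤ β) (hβ1 : β ≤ 1)
    (hlow : ∀ a, lam * ‖a‖ ^ 2 ≤ inner ℝ a (op W a))
    (hup : ∀ a, inner ℝ a (op W a) ≤ S * ‖a‖ ^ 2)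
    (hstep : h * (S + T + lam) ≤ 1)
    (hR : 4 * (√(n : ℝ) * ‖pred c x ⟨w₀, fun k => ‖w₀ k‖⟩ - y‖) ≤ R * (√(m : ℝ) * lam)) (s : ℕ) :
    NearInit w₀ R ((scaledStep c x y β h)^[s] ⟨w₀, fun k => ‖w₀ k‖⟩) ∧
    ‖pred c x ((scaledStep c x y β h)^[s] ⟨w₀, fun k => ‖w₀ k‖⟩) - y‖ ≤
      (1 - h * lam / 2) ^ s * ‖pred c x ⟨w₀, fun k => ‖w₀ k‖⟩ - y‖ := by
  set θ₀ : Params m d := ⟨w₀, fun k => ‖w₀ k‖⟩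
  set θ : ℕ → Params m d := fun s => (scaledStep c x y β h)^[s] θ₀ with hθdef
  set q := 1 - h * lam / 2 with hq
  have hsucc : ∀ s, θ (s + 1) = scaledStep c x y β h (θ s) := fun s =>
    Function.iterate_succ_apply' _ _ _
  have hm0 : (0 : ℝ) < √(m : ℝ) := Real.sqrt_pos.2 (by exact_mod_cast hI.m_pos)
  have hq0 : 0 ≤ q := by nlinarith [mul_pos hh hlam, mul_nonneg hh.le hT]
  have hR0 : 0 ≤ R := by
    by_contra hneg
    have : 0 ≤ R * (√(m : ℝ) * lam) := le_trans (by positivity) hR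
    nlinarith [mul_pos hm0 hlam]
  have hnear : ∀ {s}, (∀ k, ‖(θ s).v k - w₀ k‖ ≤ R * (1 - q ^ s)) →
      (∀ k, |(θ s).g k - ‖w₀ k‖| ≤ R * (1 - q ^ s)) → (∀ k, ‖w₀ k‖ ≤ ‖(θ s).v k‖) →
      NearInit w₀ R (θ s) := fun {s} h1 h2 h3 => by
    have : R * (1 - q ^ s) ≤ R := mul_le_of_le_one_right hR0 (by linarith [pow_nonneg hq0 s])
    exact ⟨fun k => (h1 k).trans this, fun k => (h2 k).trans this, h3⟩
  -- The bound `R (1 - q ^ s)` is the partial sum of the geometric series of increments, so it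
  -- propagates by telescoping. Closeness of iterate `s + 1` uses only the residual at `s`; it has
  -- to come first because the residual step needs both endpoints near the initialization.
  have main : ∀ s, (∀ k, ‖(θ s).v k - w₀ k‖ ≤ R * (1 - q ^ s)) ∧
      (∀ k, |(θ s).g k - ‖w₀ k‖| ≤ R * (1 - q ^ s)) ∧ (∀ k, ‖w₀ k‖ ≤ ‖(θ s).v k‖) ∧
      ‖pred c x (θ s) - y‖ ≤ q ^ s * ‖pred c x θ₀ - y‖ := by
    intro s
    induction s with
    | zero => simp [hθdef, θ₀]
    | succ s ih =>
      obtain ⟨h1, h2, h3, h4⟩ := ih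
      have hN := hnear h1 h2 h3
      have hinc : h * (2 * (1 / √(m : ℝ) * (√(n : ℝ) * ‖pred c x (θ s) - y‖))) ≤
          R * (q ^ s - q ^ (s + 1)) := by
        have e1 : R * (q ^ s - q ^ (s + 1)) = q ^ s * h / 2 * (R * (√(m : ℝ) * lam)) / √(m : ℝ) := by
          rw [pow_succ, hq]
          field_simp
          ring
        rw [e1, le_div_iff₀ hm0]
        have e2 : h * (2 * (1 / √(m : ℝ) * (√(n : ℝ) * ‖pred c x (θ s) - y‖))) * √(m : ℝ) =
          h * 2 * √(n : ℝ) * ‖pred c x (θ s) - y‖ := by field_simp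
        rw [e2]
        calc _ ≤ h * 2 * √(n : ℝ) * (q ^ s * ‖pred c x θ₀ - y‖) := by gcongr
          _ = q ^ s * h / 2 * (4 * (√(n : ℝ) * ‖pred c x θ₀ - y‖)) := by ring
          _ ≤ _ := by gcongr
      have h1' : ∀ k, ‖(θ (s + 1)).v k - w₀ k‖ ≤ R * (1 - q ^ (s + 1)) := fun k => by
        have hk := mul_le_mul_of_nonneg_left (hI.norm_gradV_le hN y k) hh.le
        rw [hsucc]
        calc _ = ‖((θ s).v k - w₀ k) - h • gradV c x y (θ s) k‖ := by
              simp only [scaledStep]; congr 1; abel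
          _ ≤ ‖(θ s).v k - w₀ k‖ + h * ‖gradV c x y (θ s) k‖ := by
              refine (norm_sub_le _ _).trans ?_
              rw [norm_smul, Real.norm_of_nonneg hh.le]
          _ ≤ _ := by linarith [h1 k]
      have h2' : ∀ k, |(θ (s + 1)).g k - ‖w₀ k‖| ≤ R * (1 - q ^ (s + 1)) := fun k => by
        have hk := hI.abs_gradG_le y (θ s) k
        have hk0 : 0 ≤ 1 / √(m : ℝ) * (√(n : ℝ) * ‖pred c x (θ s) - y‖) := by positivity
        rw [hsucc]
        calc _ = |((θ s).g k - ‖w₀ k‖) - h * β * gradG c x y (θ s) k| := by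
              simp only [scaledStep]; congr 1; ring
          _ ≤ |(θ s).g k - ‖w₀ k‖| + h * 1 * |gradG c x y (θ s) k| := by
              refine (abs_sub _ _).trans ?_
              rw [abs_mul, abs_of_nonneg (by positivity : 0 ≤ h * β)]
              gcongr
          _ ≤ |(θ s).g k - ‖w₀ k‖| +
              h * (2 * (1 / √(m : ℝ) * (√(n : ℝ) * ‖pred c x (θ s) - y‖))) := by
              rw [mul_one]; gcongr; linarith
          _ ≤ _ := by linarith [h2 k]
      have h3' : ∀ k, ‖w₀ k‖ ≤ ‖(θ (s + 1)).v k‖ := fun k => by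
        rw [hsucc]
        exact (h3 k).trans (norm_le_norm_scaledStep y h (θ s) k)
      refine ⟨h1', h2', h3', ?_⟩
      have hN' := hnear h1' h2' h3'
      rw [hsucc] at hN' ⊢
      refine (hI.norm_residual_step_le hτ hτ0 hlam hlamS hT hh hβ0 hβ1 hlow hup hstep hN
        hN').trans ?_
      rw [pow_succ', mul_assoc]
      exact mul_le_mul_of_nonneg_left h4 hq0
  obtain ⟨h1, h2, h3, h4⟩ := main s
  exact ⟨hnear h1 h2 h3, h4⟩

end Descent
-- Reduction to unit variance, and the law of the initialization.
section Scaling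
variable {m d n : ℕ}

/-- Parameters with all directions multiplied by `α`. -/
def Params.scale (α : ℝ) (θ : Params m d) : Params m d where
  v k := α • θ.v k
  g := θ.g

variable {α : ℝ}

lemma inner_smul_div_norm_smul (hα : 0 < α) (w x : Vec d) :
    inner ℝ (α • w) x / ‖α • w‖ = inner ℝ w x / ‖w‖ := by
  rw [real_inner_smul_left, norm_smul, Real.norm_of_nonneg hα.le, mul_div_mul_left _ _ hα.ne']

lemma relu_inner_smul_div_norm_smul (hα : 0 < α) (w x : Vec d) :
    relu (inner ℝ (α • w) x) / ‖α • w‖ = relu (inner ℝ w x) / ‖w‖ := by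
  rw [← relu_div (norm_nonneg _), inner_smul_div_norm_smul hα, relu_div (norm_nonneg _)]

lemma pred_scale (hα : 0 < α) (c : Fin m → ℝ) (x : Fin n → Vec d) (θ : Params m d) :
    pred c x (θ.scale α) = pred c x θ := by
  unfold pred net
  simp only [Params.scale, inner_smul_div_norm_smul hα]

lemma gramG_scale (hα : 0 < α) (x : Fin n → Vec d) (θ : Params m d) :
    gramG x (θ.scale α) = gramG x θ := by
  ext i j
  rw [gramG_eq, gramG_eq]
  simp only [Params.scale, relu_inner_smul_div_norm_smul hα]

lemma gramV_scale (hα : 0 < α) (c : Fin m → ℝ) (x : Fin n → Vec d) (θ : Params m d) :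
    gramV α c x (θ.scale α) = gramV 1 c x θ := by
  ext i j
  simp only [gramV, Matrix.of_apply, Params.scale, perp_smul hα.ne', act_smul hα, norm_smul,
    Real.norm_of_nonneg hα.le, mul_assoc, mul_div_mul_left _ _ hα.ne', one_mul]

lemma evolution_scale (hα : 0 < α) (c : Fin m → ℝ) (x : Fin n → Vec d) (θ : Params m d) :
    evolution α c x (θ.scale α) = (1 / α ^ 2) • (gramV 1 c x θ + α ^ 2 • gramG x θ) := by
  unfold evolution
  rw [gramV_scale hα, gramG_scale hα, smul_add, smul_smul, one_div_mul_cancel (by positivity),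
    one_smul]

/-- The gradient in the directions is homogeneous of degree `-1` in them, and passing from `v` to `v
/ α` divides the step once more. Hence the effective step is `η / α²` for directions, while for
lengths it remains `η = (η / α²) α²`. -/
lemma gdStep_scale (hα : 0 < α) (c : Fin m → ℝ) (x : Fin n → Vec d)
    (y : EuclideanSpace ℝ (Fin n)) (η : ℝ) (θ : Params m d) :
    gdStep c x y η (θ.scale α) = (scaledStep c x y (α ^ 2) (η / α ^ 2) θ).scale α := by
  have hV : ∀ k, gradV c x y (θ.scale α) k = (1 / α) • gradV c x y θ k := fun k => by
    unfold gradV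
    rw [pred_scale hα, smul_comm (1 / α), Finset.smul_sum (r := 1 / α)]
    refine congrArg (fun z : Vec d => (1 / √(m : ℝ)) • z) (Finset.sum_congr rfl fun i _ => ?_)
    simp only [Params.scale, perp_smul hα.ne', act_smul hα, norm_smul,
      Real.norm_of_nonneg hα.le, smul_smul]
    congr 1
    field_simp
  have hG : ∀ k, gradG c x y (θ.scale α) k = gradG c x y θ k := fun k => by
    unfold gradG
    rw [pred_scale hα]
    congr 1
    refine Finset.sum_congr rfl fun i _ => ?_
    have := relu_inner_smul_div_norm_smul hα (θ.v k) (x i)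
    simp only [Params.scale]
    rw [mul_assoc, div_mul_eq_mul_div, mul_div_assoc, this]
    ring
  simp only [gdStep, hV, hG]
  simp only [Params.scale, scaledStep, Params.mk.injEq]
  constructor
  · funext k
    rw [smul_sub, smul_smul, smul_smul]
    congr 2
    field_simp
  · funext k
    congr 2
    field_simp

lemma gdIter_scale (hα : 0 < α) (c : Fin m → ℝ) (x : Fin n → Vec d)
    (y : EuclideanSpace ℝ (Fin n)) (η : ℝ) (θ : Params m d) (s : ℕ) :
    gdIter c x y η (θ.scale α) s = ((scaledStep c x y (α ^ 2) (η / α ^ 2))^[s] θ).scale α := by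
  unfold gdIter
  induction s with
  | zero => rfl
  | succ s ih => rw [Function.iterate_succ_apply', Function.iterate_succ_apply', ih,
      gdStep_scale hα]

lemma measurable_act (x : Vec d) : Measurable fun v : Vec d => act v x :=
  Measurable.ite (measurableSet_le measurable_const (by fun_prop)) measurable_const
    measurable_const

lemma measurable_perp (x : Vec d) : Measurable fun v : Vec d => perp v x := by
  unfold perp
  fun_prop

lemma gramVInf_apply (hα : 0 < α) (x : Fin n → Vec d) (i j : Fin n) :
    gramVInf α x i j = ∫ v, inner ℝ (perp v (x i)) (perp v (x j)) * act v (x i) * act v (x j)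
      ∂(stdGaussian (Vec d)) := by
  have hm : Measurable fun v : Vec d =>
      inner ℝ (perp v (x i)) (perp v (x j)) * act v (x i) * act v (x j) :=
    (((measurable_perp _).inner (measurable_perp _)).mul (measurable_act _)).mul
      (measurable_act _)
  simp only [gramVInf, gaussian, Matrix.of_apply]
  rw [integral_map (by fun_prop) hm.aestronglyMeasurable]
  simp only [perp_smul hα.ne', act_smul hα]

lemma gramVInf_symm (x : Fin n → Vec d) (i j : Fin n) :
    gramVInf α x i j = gramVInf α x j i := by
  simp only [gramVInf, Matrix.of_apply]
  refine integral_congr_ae (Filter.Eventually.of_forall fun v => ?_)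
  simp only [real_inner_comm]
  ring

instance : IsProbabilityMeasure rademacher := by
  constructor
  simp only [rademacher, Measure.smul_apply, Measure.add_apply, measure_univ, smul_eq_mul]
  rw [one_add_one_eq_two]
  exact ENNReal.inv_mul_cancel (by norm_num) (by norm_num)

instance : IsProbabilityMeasure (gaussian d α) :=
  Measure.isProbabilityMeasure_map (by fun_prop)

/-- The law of the initialization with unit variance. -/
def baseLaw (m d : ℕ) : Measure (Fin m → Vec d × ℝ) :=
  Measure.pi fun _ => (stdGaussian (Vec d)).prod rademacher

instance : IsProbabilityMeasure (baseLaw m d) := by unfold baseLaw; infer_instance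

lemma initLaw_eq_map (α : ℝ) : initLaw m d α =
    (baseLaw m d).map fun ω k => (α • (ω k).1, (ω k).2) := by
  unfold initLaw baseLaw
  have h : (gaussian d α).prod rademacher =
      ((stdGaussian (Vec d)).prod rademacher).map (Prod.map (α • ·) id) := by
    rw [← Measure.map_prod_map _ _ (by fun_prop) measurable_id, Measure.map_id]
    rfl
  simp only [h]
  rw [← Measure.pi_map_pi (fun _ => by fun_prop)]
  rfl

/-- An event which holds on the unit variance initialization with high probability yields a
measurable event for the original one. -/
lemma exists_event_of_baseLaw (hα : 0 < α) {δ : ℝ} (P : (Fin m → Vec d × ℝ) → Prop)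
    (hP : baseLaw m d {ω | ¬ P ω} ≤ ENNReal.ofReal δ) (hδ : 0 ≤ δ) :
    ∃ E : Set (Fin m → Vec d × ℝ), MeasurableSet E ∧
      ENNReal.ofReal (1 - δ) ≤ initLaw m d α E ∧
      ∀ ω ∈ E, ∃ ω₀, P ω₀ ∧ ω = fun k => (α • (ω₀ k).1, (ω₀ k).2) := by
  -- A measurable hull has the same measure as the bad set, so measurability of `P` need not be
  -- established.
  set B := toMeasurable (baseLaw m d) {ω | ¬ P ω}
  have hB : MeasurableSet B := measurableSet_toMeasurable _ _
  set f : (Fin m → Vec d × ℝ) → (Fin m → Vec d × ℝ) := fun ω k => (α⁻¹ • (ω k).1, (ω k).2)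
  have hf : Measurable f := by fun_prop
  have hg : Measurable fun (ω : Fin m → Vec d × ℝ) k => (α • (ω k).1, (ω k).2) := by fun_prop
  refine ⟨f ⁻¹' Bᶜ, hf hB.compl, ?_, ?_⟩
  · rw [initLaw_eq_map, Measure.map_apply hg (hf hB.compl)]
    have : (fun (ω : Fin m → Vec d × ℝ) k => (α • (ω k).1, (ω k).2)) ⁻¹' (f ⁻¹' Bᶜ) = Bᶜ := by
      ext ω
      simp [f, smul_smul, inv_mul_cancel₀ hα.ne']
    rw [this, prob_compl_eq_one_sub hB, measure_toMeasurable, ENNReal.ofReal_sub _ hδ,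
      ENNReal.ofReal_one]
    exact tsub_le_tsub_left hP 1
  · intro ω hω
    refine ⟨f ω, ?_, ?_⟩
    · by_contra h
      exact hω (subset_toMeasurable _ _ h)
    · funext k
      simp [f, smul_smul, mul_inv_cancel₀ hα.ne']

end Scaling
-- Small balls, kinks and moment generating functions of the Gaussian.
section GaussianFacts
variable {d : ℕ}

lemma integral_exp_neg_mul_sq_gaussianReal {t : ℝ} (ht : 0 ≤ t) :
    ∫ z, Real.exp (-t * z ^ 2) ∂(gaussianReal 0 1) = 1 / √(1 + 2 * t) := by
  rw [integral_gaussianReal_eq_integral_smul (by norm_num)]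
  have : ∀ z : ℝ, gaussianPDFReal 0 1 z • Real.exp (-t * z ^ 2) =
      (√(2 * Real.pi))⁻¹ * Real.exp (-(t + 1 / 2) * z ^ 2) := fun z => by
    simp only [gaussianPDFReal, NNReal.coe_one, mul_one, sub_zero, smul_eq_mul]
    rw [mul_assoc, ← Real.exp_add]
    congr 2
    ring
  simp only [this]
  rw [integral_const_mul, integral_gaussian, ← Real.sqrt_inv, ← Real.sqrt_mul (by positivity),
    ← Real.sqrt_one, ← Real.sqrt_div zero_le_one, Real.sqrt_one]
  congr 1
  have := Real.pi_pos
  field_simp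
  ring

lemma integral_exp_neg_mul_norm_sq {t : ℝ} (ht : 0 ≤ t) :
    ∫ w, Real.exp (-t * ‖w‖ ^ 2) ∂(stdGaussian (Vec d)) = (1 / √(1 + 2 * t)) ^ d := by
  rw [← map_pi_eq_stdGaussian, integral_map (by fun_prop) (by fun_prop)]
  simp only [EuclideanSpace.norm_sq_eq, Real.norm_eq_abs, sq_abs, Finset.mul_sum, Real.exp_sum]
  rw [integral_fintype_prod_eq_pow (fun z : ℝ => Real.exp (-t * z ^ 2)),
    integral_exp_neg_mul_sq_gaussianReal ht, Fintype.card_fin]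

lemma measureReal_norm_le_le (hd : 0 < d) {r : ℝ} (hr : 0 < r) :
    (stdGaussian (Vec d)).real {w | ‖w‖ ≤ r} ≤ (√(Real.exp 1 / d) * r) ^ d := by
  have hd0 : (0 : ℝ) < d := by exact_mod_cast hd
  -- Chernoff bound with the parameter for which `t r² = d / 2`, up to lower order the optimal
  -- choice.
  set t : ℝ := d / (2 * r ^ 2) with ht
  have ht0 : 0 < t := by positivity
  have hint : Integrable (fun w : Vec d => Real.exp (-t * ‖w‖ ^ 2)) (stdGaussian (Vec d)) := by
    refine Integrable.of_bound (C := 1) (by fun_prop) (Filter.Eventually.of_forall fun w => ?_)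
    rw [Real.norm_of_nonneg (Real.exp_pos _).le, Real.exp_le_one_iff]
    nlinarith [sq_nonneg ‖w‖]
  have h1 := mul_meas_ge_le_integral_of_nonneg
    (Filter.Eventually.of_forall fun w : Vec d => (Real.exp_pos (-t * ‖w‖ ^ 2)).le) hint
    (Real.exp (-(d / 2 : ℝ)))
  rw [integral_exp_neg_mul_norm_sq ht0.le] at h1
  have hsub : {w : Vec d | ‖w‖ ≤ r} ⊆
      {w | Real.exp (-(d / 2 : ℝ)) ≤ Real.exp (-t * ‖w‖ ^ 2)} := by
    intro w hw
    have hw' : ‖w‖ ^ 2 ≤ r ^ 2 := pow_le_pow_left₀ (norm_nonneg _) hw 2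
    have h : t * ‖w‖ ^ 2 ≤ (d : ℝ) / 2 := by
      calc t * ‖w‖ ^ 2 ≤ t * r ^ 2 := by gcongr
        _ = (d : ℝ) / 2 := by rw [ht]; field_simp
    simp only [Set.mem_ofPred_eq, Real.exp_le_exp]
    linarith
  have h2 := measureReal_mono (μ := stdGaussian (Vec d)) hsub
  have h3 : (stdGaussian (Vec d)).real {w | Real.exp (-(d / 2 : ℝ)) ≤ Real.exp (-t * ‖w‖ ^ 2)} ≤
      Real.exp (d / 2 : ℝ) * (1 / √(1 + 2 * t)) ^ d := by
    have := mul_le_mul_of_nonneg_left h1 (Real.exp_pos (d / 2 : ℝ)).le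
    rwa [← mul_assoc, ← Real.exp_add, add_neg_cancel, Real.exp_zero, one_mul] at this
  refine h2.trans (h3.trans ?_)
  have e1 : Real.exp (d / 2 : ℝ) = √(Real.exp 1) ^ d := by
    rw [← Real.exp_half, ← Real.exp_nat_mul]
    ring_nf
  rw [e1, ← mul_pow]
  refine pow_le_pow_left₀ (by positivity) ?_ d
  have e2 : 1 / √(1 + 2 * t) ≤ r / √d := by
    rw [div_le_div_iff₀ (by positivity) (by positivity), one_mul]
    rw [← Real.sqrt_sq hr.le, ← Real.sqrt_mul (by positivity)]
    refine Real.sqrt_le_sqrt ?_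
    rw [mul_add, ht]
    have : r ^ 2 * (2 * (d / (2 * r ^ 2))) = d := by field_simp
    rw [this]
    nlinarith [sq_nonneg r]
  calc _ ≤ √(Real.exp 1) * (r / √d) := by gcongr
    _ = _ := by rw [Real.sqrt_div (Real.exp_pos 1).le]; ring

/-- The shape of the bound is chosen so that `r = 1 / t` gives the integrable tail `2 / (1 + t²)`,
whose integral over the half-line is `π`. For `r ≤ 1` it uses `e / d ≤ 1`, hence `d ≥ 3`. -/
lemma measureReal_norm_le_le_sq (hd : 3 ≤ d) {r : ℝ} (hr : 0 < r) :
    (stdGaussian (Vec d)).real {w | ‖w‖ ≤ r} ≤ 2 * r ^ 2 / (1 + r ^ 2) := by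
  rw [le_div_iff₀ (by positivity)]
  have h1 : (stdGaussian (Vec d)).real {w | ‖w‖ ≤ r} ≤ 1 := measureReal_le_one
  have h0 : 0 ≤ (stdGaussian (Vec d)).real {w | ‖w‖ ≤ r} := measureReal_nonneg
  rcases le_total 1 r with h | h
  · nlinarith
  · have h2 := measureReal_norm_le_le (by omega : 0 < d) hr
    have h3 : √(Real.exp 1 / d) ≤ 1 := by
      refine Real.sqrt_le_one.2 ?_
      rw [div_le_one (by positivity)]
      have : (3 : ℝ) ≤ d := by exact_mod_cast hd
      linarith [Real.exp_one_lt_three]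
    have h4 : (√(Real.exp 1 / d) * r) ^ d ≤ r ^ 2 := by
      calc _ ≤ r ^ d := pow_le_pow_left₀ (by positivity) (mul_le_of_le_one_left hr.le h3) d
        _ ≤ r ^ 2 := pow_le_pow_of_le_one hr.le h (by omega)
    have h5 := h2.trans h4
    nlinarith [sq_nonneg r]

lemma lintegral_inv_norm_le (hd : 3 ≤ d) :
    ∫⁻ w, ENNReal.ofReal (1 / ‖w‖) ∂(stdGaussian (Vec d)) ≤ ENNReal.ofReal Real.pi := by
  rw [lintegral_eq_lintegral_meas_lt _ (Filter.Eventually.of_forall fun w => by positivity)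
    (by fun_prop)]
  have hI : IntegrableOn (fun t : ℝ => 2 * (1 + t ^ 2)⁻¹) (Set.Ioi 0) :=
    (integrable_inv_one_add_sq.const_mul 2).integrableOn
  calc _ ≤ ∫⁻ t in Set.Ioi (0 : ℝ), ENNReal.ofReal (2 * (1 + t ^ 2)⁻¹) := by
        refine setLIntegral_mono' measurableSet_Ioi fun t ht => ?_
        have ht : 0 < t := ht
        calc _ ≤ (stdGaussian (Vec d)) {w | ‖w‖ ≤ 1 / t} := by
              refine measure_mono fun w hw => ?_
              simp only [Set.mem_ofPred_eq] at hw ⊢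
              rcases (norm_nonneg w).eq_or_lt with h | h
              · rw [← h]; positivity
              · rw [lt_div_iff₀ h] at hw
                rw [le_div_iff₀ ht]
                linarith
          _ = ENNReal.ofReal ((stdGaussian (Vec d)).real {w | ‖w‖ ≤ 1 / t}) := by
              rw [ofReal_measureReal]
          _ ≤ _ := by
              refine ENNReal.ofReal_le_ofReal ?_
              refine (measureReal_norm_le_le_sq hd (by positivity : 0 < 1 / t)).trans ?_
              apply le_of_eq
              field_simp
              ring
    _ = ENNReal.ofReal (∫ t in Set.Ioi (0 : ℝ), 2 * (1 + t ^ 2)⁻¹) :=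
        (ofReal_integral_eq_lintegral_ofReal hI
          (Filter.Eventually.of_forall fun t => by positivity)).symm
    _ = _ := by
        rw [integral_const_mul, integral_Ioi_inv_one_add_sq]
        congr 1
        simp
        ring

lemma integral_min_div_norm_le (hd : 3 ≤ d) {R : ℝ} (hR : 0 ≤ R) :
    ∫ w, min 1 (R / ‖w‖) ∂(stdGaussian (Vec d)) ≤ 4 * R := by
  rw [integral_eq_lintegral_of_nonneg_ae
    (Filter.Eventually.of_forall fun w => by positivity)
    (by fun_prop : Measurable fun w : Vec d => min 1 (R / ‖w‖)).aestronglyMeasurable]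
  refine ENNReal.toReal_le_of_le_ofReal (by positivity) ?_
  calc _ ≤ ∫⁻ w, ENNReal.ofReal R * ENNReal.ofReal (1 / ‖w‖) ∂(stdGaussian (Vec d)) := by
        refine lintegral_mono fun w => ?_
        rw [← ENNReal.ofReal_mul hR, mul_one_div]
        exact ENNReal.ofReal_le_ofReal (min_le_right _ _)
    _ = ENNReal.ofReal R * ∫⁻ w, ENNReal.ofReal (1 / ‖w‖) ∂(stdGaussian (Vec d)) := by
        rw [lintegral_const_mul _ (by fun_prop)]
    _ ≤ ENNReal.ofReal R * ENNReal.ofReal Real.pi := by gcongr; exact lintegral_inv_norm_le hd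
    _ = ENNReal.ofReal (R * Real.pi) := (ENNReal.ofReal_mul hR).symm
    _ ≤ _ := ENNReal.ofReal_le_ofReal (by nlinarith [Real.pi_lt_four])

lemma map_inner_stdGaussian (x : Vec d) :
    (stdGaussian (Vec d)).map (fun w => inner ℝ w x) = gaussianReal 0 (‖x‖₊ ^ 2) := by
  have h := IsGaussian.map_eq_gaussianReal (μ := stdGaussian (Vec d)) (innerSL ℝ x)
  rw [integral_strongDual_stdGaussian, variance_dual_stdGaussian, innerSL_apply_norm] at h
  have e : (fun w : Vec d => inner ℝ w x) = innerSL ℝ x := by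
    funext w; rw [innerSL_apply_apply, real_inner_comm]
  rw [e, h]
  congr 1
  ext
  simp

/-- The density is at most `1 / (√(2π) s) ≤ 1 / (2 s)`, and the interval has length `2 R s`. -/
lemma gaussianReal_abs_le_le {s : NNReal} (hs : s ≠ 0) (R : ℝ) :
    gaussianReal 0 (s ^ 2) {z | |z| ≤ R * s} ≤ ENNReal.ofReal R := by
  have hs0 : (0 : ℝ) < s := by exact_mod_cast pos_iff_ne_zero.2 hs
  rw [gaussianReal_apply _ (pow_ne_zero 2 hs)]
  have e : {z : ℝ | |z| ≤ R * s} = Set.Icc (-(R * s)) (R * s) := by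
    ext z; simp [abs_le]
  have hpi : (1 : ℝ) ≤ Real.pi := by linarith [Real.pi_gt_three]
  calc _ ≤ ∫⁻ _z in {z : ℝ | |z| ≤ R * s}, ENNReal.ofReal ((2 * s)⁻¹) := by
        refine lintegral_mono fun z => ENNReal.ofReal_le_ofReal ?_
        unfold gaussianPDFReal
        calc _ ≤ (√(2 * Real.pi * ((s ^ 2 : NNReal) : ℝ)))⁻¹ * 1 := by
              gcongr
              rw [Real.exp_le_one_iff]
              exact div_nonpos_of_nonpos_of_nonneg (by nlinarith [sq_nonneg (z - 0)]) (by positivity)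
          _ ≤ _ := by
              rw [mul_one]
              gcongr
              refine Real.le_sqrt_of_sq_le ?_
              push_cast
              nlinarith [sq_nonneg (s : ℝ), Real.pi_gt_three]
    _ = ENNReal.ofReal R := by
        rw [setLIntegral_const, e, Real.volume_Icc, ← ENNReal.ofReal_mul (by positivity)]
        congr 1
        field_simp
        ring

lemma measurable_nearKink (R : ℝ) (x : Vec d) : Measurable fun w : Vec d => nearKink R w x :=
  Measurable.ite (measurableSet_le (by fun_prop) measurable_const) measurable_const
    measurable_const

lemma integral_nearKink_le {x : Vec d} (hx : x ≠ 0) {R : ℝ} (hR : 0 ≤ R) :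
    ∫ w, nearKink R w x ∂(stdGaussian (Vec d)) ≤ R := by
  have e : (fun w : Vec d => nearKink R w x) =
      ({w : Vec d | |inner ℝ w x| ≤ R * ‖x‖} : Set (Vec d)).indicator 1 := by
    funext w
    simp [nearKink, Set.indicator_apply]
  have hms : MeasurableSet {w : Vec d | |inner ℝ w x| ≤ R * ‖x‖} :=
    measurableSet_le (by fun_prop) measurable_const
  rw [e, integral_indicator_one hms]
  refine ENNReal.toReal_le_of_le_ofReal hR ?_
  have h := gaussianReal_abs_le_le (s := ‖x‖₊) (by simpa using hx) R
  rw [← map_inner_stdGaussian, Measure.map_apply (by fun_prop)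
    (measurableSet_le (by fun_prop) measurable_const)] at h
  exact h

lemma ae_inner_ne_zero {x : Vec d} (hx : x ≠ 0) :
    ∀ᵐ w ∂(stdGaussian (Vec d)), inner ℝ w x ≠ 0 := by
  have h := gaussianReal_abs_le_le (s := ‖x‖₊) (by simpa using hx) 0
  rw [← map_inner_stdGaussian, Measure.map_apply (by fun_prop)
    (measurableSet_le (by fun_prop) measurable_const)] at h
  rw [ae_iff]
  simp only [zero_mul, abs_nonpos_iff, ENNReal.ofReal_zero, nonpos_iff_eq_zero] at h
  simp only [not_not]
  exact h

lemma integral_exp_mul_inner (x : Vec d) (t : ℝ) :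
    Integrable (fun w => Real.exp (t * inner ℝ w x)) (stdGaussian (Vec d)) ∧
    ∫ w, Real.exp (t * inner ℝ w x) ∂(stdGaussian (Vec d)) = Real.exp (‖x‖ ^ 2 * t ^ 2 / 2) := by
  have h1 := mgf_gaussianReal (map_inner_stdGaussian x) t
  have h2 : Integrable (fun z => Real.exp (t * z)) (gaussianReal 0 (‖x‖₊ ^ 2)) :=
    integrable_exp_mul_gaussianReal t
  rw [← map_inner_stdGaussian] at h2
  refine ⟨h2.comp_measurable (by fun_prop), ?_⟩
  simpa [mgf] using h1

/-- Averaging over the sign turns the exponential into `cosh (t relu z)`, which is at most `cosh (t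
z)`; the Gaussian integral of the latter is `exp (‖x‖² t² / 2)`. -/
lemma hasSubgaussianMGF_sign_mul_relu {x : Vec d} (hx : ‖x‖ ≤ 1) :
    HasSubgaussianMGF (fun p : Vec d × ℝ => p.2 * relu (inner ℝ p.1 x)) 1
      ((stdGaussian (Vec d)).prod rademacher) := by
  have hrelu : ∀ t : ℝ, ∀ s : ℝ, Real.exp (t * relu s) ≤ Real.exp (t * s) + 1 := fun t s => by
    unfold relu
    rcases le_total 0 s with h | h
    · rw [max_eq_left h]; linarith
    · rw [max_eq_right h]; simp [(Real.exp_pos _).le]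
  have hmr : Measurable fun w : Vec d => relu (inner ℝ w x) := by
    unfold relu; fun_prop
  have hmp : Measurable fun p : Vec d × ℝ => p.2 * relu (inner ℝ p.1 x) :=
    measurable_snd.mul (hmr.comp measurable_fst)
  have hint1 : ∀ t : ℝ, Integrable (fun w => Real.exp (t * relu (inner ℝ w x)))
      (stdGaussian (Vec d)) := fun t => by
    refine Integrable.mono' ((integral_exp_mul_inner x t).1.add (integrable_const 1))
      (Real.measurable_exp.comp (hmr.const_mul t)).aestronglyMeasurable
      (Filter.Eventually.of_forall fun w => ?_)
    rw [Real.norm_of_nonneg (Real.exp_pos _).le]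
    exact hrelu t _
  have hrad : ∀ᵐ c ∂rademacher, c = -1 ∨ c = 1 := by
    unfold rademacher
    refine Measure.ae_smul_measure ?_ _
    rw [ae_add_measure_iff]
    constructor
    · rw [ae_dirac_iff (by measurability)]; simp
    · rw [ae_dirac_iff (by measurability)]; simp
  have hint : ∀ t : ℝ, Integrable (fun p : Vec d × ℝ => Real.exp (t * (p.2 * relu (inner ℝ p.1 x))))
      ((stdGaussian (Vec d)).prod rademacher) := fun t => by
    have hg : Integrable (fun p : Vec d × ℝ => Real.exp (t * relu (inner ℝ p.1 x)) +
        Real.exp (-t * relu (inner ℝ p.1 x))) ((stdGaussian (Vec d)).prod rademacher) :=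
      ((hint1 t).add (hint1 (-t))).comp_fst _
    refine hg.mono' (Real.measurable_exp.comp (hmp.const_mul t)).aestronglyMeasurable ?_
    have : ∀ᵐ p ∂((stdGaussian (Vec d)).prod rademacher), p.2 = -1 ∨ p.2 = 1 :=
      Measure.quasiMeasurePreserving_snd.ae hrad
    filter_upwards [this] with p hp
    rw [Real.norm_of_nonneg (Real.exp_pos _).le]
    rcases hp with hp | hp <;> rw [hp]
    · have := (Real.exp_pos (t * relu (inner ℝ p.1 x))).le
      simp only [neg_mul, one_mul, mul_neg]
      linarith
    · have := (Real.exp_pos (-t * relu (inner ℝ p.1 x))).le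
      simp only [one_mul]
      linarith
  refine ⟨hint, fun t => ?_⟩
  unfold mgf
  rw [integral_prod _ (hint t)]
  have hin : ∀ w : Vec d, ∫ c, Real.exp (t * (c * relu (inner ℝ w x))) ∂rademacher =
      (Real.exp (-t * relu (inner ℝ w x)) + Real.exp (t * relu (inner ℝ w x))) / 2 := fun w => by
    unfold rademacher
    rw [integral_smul_measure, integral_add_measure (integrable_dirac (by simp))
      (integrable_dirac (by simp)), integral_dirac, integral_dirac]
    simp
    ring
  simp only [hin]
  have hcosh : ∀ w : Vec d,
      (Real.exp (-t * relu (inner ℝ w x)) + Real.exp (t * relu (inner ℝ w x))) / 2 ≤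
      (Real.exp (-t * inner ℝ w x) + Real.exp (t * inner ℝ w x)) / 2 := fun w => by
    rcases le_total 0 (inner ℝ w x : ℝ) with h | h
    · simp [relu, h]
    · simp only [relu, max_eq_right h, mul_zero, Real.exp_zero]
      have := Real.one_le_cosh (t * inner ℝ w x)
      rw [Real.cosh_eq] at this
      rw [neg_mul]
      linarith
  obtain ⟨i1, v1⟩ := integral_exp_mul_inner x t
  obtain ⟨i2, v2⟩ := integral_exp_mul_inner x (-t)
  calc _ ≤ ∫ w, (Real.exp (-t * inner ℝ w x) + Real.exp (t * inner ℝ w x)) / 2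
        ∂(stdGaussian (Vec d)) :=
        integral_mono (((hint1 (-t)).add (hint1 t)).div_const 2) ((i2.add i1).div_const 2) hcosh
    _ = Real.exp (‖x‖ ^ 2 * t ^ 2 / 2) := by
        rw [integral_div, integral_add i2 i1, v1, v2]
        ring_nf
    _ ≤ _ := by
        rw [Real.exp_le_exp, NNReal.coe_one]
        have : ‖x‖ ^ 2 ≤ 1 := pow_le_one₀ (norm_nonneg _) hx
        nlinarith [sq_nonneg t]

end GaussianFacts

/-! ### Concentration of empirical averages of independent copies. -/

section Concentration
variable {Ω₀ : Type*} [MeasurableSpace Ω₀] {ν : Measure Ω₀} [IsProbabilityMeasure ν] {m : ℕ}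

lemma pi_abs_avg_gt_le {X : Ω₀ → ℝ} (hX : HasSubgaussianMGF X 1 ν) (hm : 0 < m) {t : ℝ}
    (ht : 0 ≤ t) :
    (Measure.pi fun _ : Fin m => ν) {ω | t < |(1 / (m : ℝ)) * ∑ k, X (ω k)|} ≤
      ENNReal.ofReal (2 * Real.exp (-(m * t ^ 2 / 2))) := by
  have hm0 : (0 : ℝ) < m := by exact_mod_cast hm
  have key : ∀ Y : Ω₀ → ℝ, HasSubgaussianMGF Y 1 ν →
      (Measure.pi fun _ : Fin m => ν).real {ω | m * t ≤ ∑ k, Y (ω k)} ≤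
        Real.exp (-(m * t ^ 2 / 2)) := fun Y hY => by
    have hind : iIndepFun (fun (k : Fin m) ω => Y (ω k)) (Measure.pi fun _ : Fin m => ν) :=
      iIndepFun_pi fun _ => hY.aemeasurable
    have hsub : ∀ k : Fin m, HasSubgaussianMGF (fun ω : Fin m → Ω₀ => Y (ω k)) 1
        (Measure.pi fun _ : Fin m => ν) := fun k => by
      have hmp := measurePreserving_eval (fun _ : Fin m => ν) k
      refine HasSubgaussianMGF.of_map (Y := Function.eval k) hmp.measurable.aemeasurable ?_
      rwa [hmp.map_eq]
    have := HasSubgaussianMGF.measure_sum_ge_le_of_iIndepFun hind (s := Finset.univ)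
      (c := fun _ => 1) (fun k _ => hsub k) (ε := m * t) (by positivity)
    refine this.trans (le_of_eq ?_)
    congr 1
    simp
    field_simp
  have hneg : HasSubgaussianMGF (fun p => -X p) 1 ν := hX.neg
  have hsubset : {ω : Fin m → Ω₀ | t < |(1 / (m : ℝ)) * ∑ k, X (ω k)|} ⊆
      {ω | m * t ≤ ∑ k, X (ω k)} ∪ {ω | m * t ≤ ∑ k, -X (ω k)} := by
    intro ω hω
    simp only [Set.mem_ofPred_eq, Set.mem_union] at hω ⊢
    rw [abs_mul, abs_of_pos (by positivity), one_div, inv_mul_eq_div, lt_div_iff₀ hm0,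
      lt_abs] at hω
    rw [Finset.sum_neg_distrib]
    rcases hω with h | h
    · left; linarith
    · right; linarith
  refine (measure_mono hsubset).trans ((measure_union_le _ _).trans ?_)
  rw [← ofReal_measureReal, ← ofReal_measureReal, ← ENNReal.ofReal_add measureReal_nonneg
    measureReal_nonneg]
  refine ENNReal.ofReal_le_ofReal ?_
  linarith [key X hX, key _ hneg]

/-- Hoeffding's inequality for empirical averages of a bounded function. -/
lemma pi_abs_avg_sub_integral_gt_le {f : Ω₀ → ℝ} (hf : Measurable f) (hb : ∀ p, |f p| ≤ 1)
    (hm : 0 < m) {t : ℝ} (ht : 0 ≤ t) :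
    (Measure.pi fun _ : Fin m => ν) {ω | t < |(1 / (m : ℝ)) * ∑ k, f (ω k) - ∫ p, f p ∂ν|} ≤
      ENNReal.ofReal (2 * Real.exp (-(m * t ^ 2 / 2))) := by
  have hm0 : (0 : ℝ) < m := by exact_mod_cast hm
  have h := hasSubgaussianMGF_of_mem_Icc (μ := ν) (a := -1) (b := 1) hf.aemeasurable
    (Filter.Eventually.of_forall fun p => abs_le.1 (hb p))
  have hc : ((‖(1 : ℝ) - (-1)‖₊ / 2) ^ 2 : NNReal) = 1 := by
    ext
    norm_num
  rw [hc] at h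
  have := pi_abs_avg_gt_le h hm ht
  convert this using 6 with ω
  rw [Finset.sum_sub_distrib, mul_sub]
  simp
  field_simp

end Concentration
-- Spectrum of the limiting matrix `V^∞`.
section GramVInf
variable {d n : ℕ} {α : ℝ}

lemma norm_sum_act_perp_le (x : Fin n → Vec d) (hx : ∀ i, ‖x i‖ ≤ 1)
    (a : EuclideanSpace ℝ (Fin n)) (w : Vec d) :
    ‖perp w (∑ i, (a i * act w (x i)) • x i)‖ ≤ ∑ i, |a i| := by
  refine (norm_perp_le _ _).trans ((norm_sum_le _ _).trans (Finset.sum_le_sum fun i _ => ?_))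
  rw [norm_smul, Real.norm_eq_abs, abs_mul, mul_assoc]
  exact mul_le_of_le_one_right (abs_nonneg _)
    (mul_le_one₀ (abs_act_le_one _ _) (norm_nonneg _) (hx i))

lemma measurable_sum_act_perp (x : Fin n → Vec d) (a : EuclideanSpace ℝ (Fin n)) :
    Measurable fun w : Vec d => perp w (∑ i, (a i * act w (x i)) • x i) := by
  simp only [perp_sum, perp_smul_right]
  exact Finset.measurable_sum _ fun i _ =>
    ((measurable_act (x i)).const_mul (a i)).smul (measurable_perp (x i))

lemma integrable_sum_act_perp (x : Fin n → Vec d) (hx : ∀ i, ‖x i‖ ≤ 1)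
    (a : EuclideanSpace ℝ (Fin n)) :
    Integrable (fun w => ‖perp w (∑ i, (a i * act w (x i)) • x i)‖ ^ 2)
      (stdGaussian (Vec d)) := by
  refine Integrable.of_bound (C := (∑ i, |a i|) ^ 2)
    ((measurable_sum_act_perp x a).norm.pow_const 2).aestronglyMeasurable
    (Filter.Eventually.of_forall fun w => ?_)
  rw [Real.norm_of_nonneg (by positivity)]
  exact pow_le_pow_left₀ (norm_nonneg _) (norm_sum_act_perp_le x hx a w) 2

lemma abs_gramVInf_integrand_le {x : Fin n → Vec d} (hx : ∀ i, ‖x i‖ ≤ 1) (i j : Fin n)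
    (w : Vec d) :
    |inner ℝ (perp w (x i)) (perp w (x j)) * act w (x i) * act w (x j)| ≤ 1 := by
  rw [abs_mul, abs_mul]
  exact mul_le_one₀ (mul_le_one₀ (abs_inner_perp_le w (hx i) (hx j)) (abs_nonneg _)
    (abs_act_le_one _ _)) (abs_nonneg _) (abs_act_le_one _ _)

lemma measurable_gramVInf_integrand (x : Fin n → Vec d) (i j : Fin n) :
    Measurable fun w : Vec d =>
      inner ℝ (perp w (x i)) (perp w (x j)) * act w (x i) * act w (x j) :=
  (((measurable_perp _).inner (measurable_perp _)).mul (measurable_act _)).mul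
    (measurable_act _)

/-- Since `perp w` is linear, the form is the mean of a square. Both the lower bound by the data
Gram matrix and strict positivity start from here. -/
lemma inner_op_gramVInf (hα : 0 < α) (x : Fin n → Vec d) (hx : ∀ i, ‖x i‖ ≤ 1)
    (a : EuclideanSpace ℝ (Fin n)) :
    inner ℝ a (op (gramVInf α x) a) =
      ∫ w, ‖perp w (∑ i, (a i * act w (x i)) • x i)‖ ^ 2 ∂(stdGaussian (Vec d)) := by
  have hint : ∀ i j, Integrable (fun w : Vec d =>
      inner ℝ (perp w (x i)) (perp w (x j)) * act w (x i) * act w (x j))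
      (stdGaussian (Vec d)) := fun i j =>
    Integrable.of_bound (C := 1) (measurable_gramVInf_integrand x i j).aestronglyMeasurable
      (Filter.Eventually.of_forall fun w => abs_gramVInf_integrand_le hx i j w)
  rw [inner_op]
  simp only [gramVInf_apply hα, ← integral_const_mul, ← integral_mul_const]
  simp_rw [← integral_finsetSum _ (fun j _ => ((hint _ j).const_mul (a _)).mul_const (a j))]
  rw [← integral_finsetSum _ (fun i _ => integrable_finsetSum _
    (fun j _ => ((hint i j).const_mul (a i)).mul_const (a j)))]
  refine integral_congr_ae (Filter.Eventually.of_forall fun w => ?_)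
  simp only [perp_sum, perp_smul_right]
  rw [← real_inner_self_eq_norm_sq, sum_inner]
  refine Finset.sum_congr rfl fun i _ => ?_
  rw [inner_sum]
  refine Finset.sum_congr rfl fun j _ => ?_
  rw [real_inner_smul_left, real_inner_smul_right]
  ring

lemma integrable_sq_inner_div_norm (x : Vec d) :
    Integrable (fun w => (inner ℝ w x / ‖w‖) ^ 2) (stdGaussian (Vec d)) := by
  refine Integrable.of_bound (C := ‖x‖ ^ 2) (by fun_prop : Measurable fun w : Vec d =>
    (inner ℝ w x / ‖w‖) ^ 2).aestronglyMeasurable (Filter.Eventually.of_forall fun w => ?_)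
  rw [Real.norm_of_nonneg (by positivity), ← sq_abs]
  exact pow_le_pow_left₀ (abs_nonneg _) (abs_inner_div_norm_le w x) 2

/-- By rotation invariance each direction carries a `1/d` fraction of the squared norm. -/
lemma integral_sq_inner_div_norm_le (hd : 0 < d) (x : Vec d) :
    ∫ w, (inner ℝ w x / ‖w‖) ^ 2 ∂(stdGaussian (Vec d)) ≤ ‖x‖ ^ 2 / d := by
  have hd0 : (0 : ℝ) < d := by exact_mod_cast hd
  have hrot : ∀ z : Vec d, ‖z‖ = ‖x‖ →
      ∫ w, (inner ℝ w x / ‖w‖) ^ 2 ∂(stdGaussian (Vec d)) =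
      ∫ w, (inner ℝ w z / ‖w‖) ^ 2 ∂(stdGaussian (Vec d)) := fun z hz => by
    -- Vectors of equal norm are exchanged by a reflection, which preserves the Gaussian law.
    set f : Vec d ≃ₗᵢ[ℝ] Vec d := (ℝ ∙ (x - z))ᗮ.reflection
    have hf : f x = z := Submodule.reflection_sub hz.symm
    have hmap := stdGaussian_map f
    conv_rhs => rw [← hmap]
    rw [integral_map (by fun_prop) (by fun_prop : Measurable fun w : Vec d =>
      (inner ℝ w z / ‖w‖) ^ 2).aestronglyMeasurable]
    refine integral_congr_ae (Filter.Eventually.of_forall fun w => ?_)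
    simp only
    rw [← hf, f.inner_map_map, f.norm_map]
  have hsum : ∑ l : Fin d, ∫ w, (inner ℝ w (EuclideanSpace.single l ‖x‖ : Vec d) / ‖w‖) ^ 2
      ∂(stdGaussian (Vec d)) ≤ ‖x‖ ^ 2 := by
    rw [← integral_finsetSum _ fun l _ => integrable_sq_inner_div_norm _]
    calc _ ≤ ∫ _w, ‖x‖ ^ 2 ∂(stdGaussian (Vec d)) := by
          refine integral_mono (integrable_finsetSum _ fun l _ => integrable_sq_inner_div_norm _)
            (integrable_const _) fun w => ?_
          have : ∑ l : Fin d, (inner ℝ w (EuclideanSpace.single l ‖x‖ : Vec d) / ‖w‖) ^ 2 =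
              ‖x‖ ^ 2 * (‖w‖ ^ 2 / ‖w‖ ^ 2) := by
            rw [EuclideanSpace.norm_sq_eq w, Finset.sum_div, Finset.mul_sum]
            refine Finset.sum_congr rfl fun l _ => ?_
            rw [← EuclideanSpace.norm_sq_eq w, EuclideanSpace.inner_single_right]
            simp
            ring
          simp only [this]
          exact mul_le_of_le_one_right (by positivity) (div_self_le_one _)
      _ = _ := by simp
  have heq : ∀ l : Fin d, ∫ w, (inner ℝ w (EuclideanSpace.single l ‖x‖ : Vec d) / ‖w‖) ^ 2
      ∂(stdGaussian (Vec d)) = ∫ w, (inner ℝ w x / ‖w‖) ^ 2 ∂(stdGaussian (Vec d)) :=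
    fun l => (hrot _ (by simp)).symm
  simp only [heq, Finset.sum_const, Finset.card_univ, Fintype.card_fin, nsmul_eq_mul] at hsum
  rw [le_div_iff₀ hd0]
  linarith

lemma norm_perp_sq (w u : Vec d) : ‖perp w u‖ ^ 2 = ‖u‖ ^ 2 - (inner ℝ w u / ‖w‖) ^ 2 := by
  rw [← real_inner_self_eq_norm_sq, inner_perp_perp_eq, real_inner_self_eq_norm_sq, sq (_ / _)]

lemma act_neg_add_act {w x : Vec d} (h : inner ℝ w x ≠ 0) : act (-w) x + act w x = 1 := by
  unfold act
  rw [inner_neg_left]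
  rcases lt_or_gt_of_ne h with h | h
  · simp [not_le.2 h, h.le]
  · simp [not_le.2 h, h.le]

/-- The auxiliary Gram matrix dominates a multiple of the Gram matrix of the data. -/
lemma norm_sum_sq_le_inner_op_gramVInf (hd : 2 ≤ d) (hα : 0 < α) (x : Fin n → Vec d)
    (hx : ∀ i, ‖x i‖ ≤ 1) (hx0 : ∀ i, x i ≠ 0) (a : EuclideanSpace ℝ (Fin n)) :
    1 / 8 * ‖∑ i, a i • x i‖ ^ 2 ≤ inner ℝ a (op (gramVInf α x) a) := by
  set u := ∑ i, a i • x i with hu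
  set F : Vec d → ℝ := fun w => ‖perp w (∑ i, (a i * act w (x i)) • x i)‖ ^ 2 with hF
  have hFi : Integrable F (stdGaussian (Vec d)) := integrable_sum_act_perp x hx a
  have hmp : MeasurePreserving (fun w : Vec d => -w) (stdGaussian (Vec d))
      (stdGaussian (Vec d)) := ⟨by fun_prop, stdGaussian_map (LinearIsometryEquiv.neg ℝ)⟩
  have hneg : ∫ w, F (-w) ∂(stdGaussian (Vec d)) = ∫ w, F w ∂(stdGaussian (Vec d)) :=
    hmp.integral_comp (Homeomorph.neg (Vec d)).measurableEmbedding F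
  have hFn : Integrable (fun w => F (-w)) (stdGaussian (Vec d)) :=
    hmp.integrable_comp_of_integrable hFi
  -- Almost surely `w` and `-w` activate complementary sets of data, so the two active sums add up
  -- to `u`. Symmetry of the law makes both terms contribute equally.
  have hpt : ∀ᵐ w ∂(stdGaussian (Vec d)), 1 / 2 * ‖perp w u‖ ^ 2 ≤ F (-w) + F w := by
    have hae : ∀ᵐ w ∂(stdGaussian (Vec d)), ∀ i, inner ℝ w (x i) ≠ 0 :=
      ae_all_iff.2 fun i => ae_inner_ne_zero (hx0 i)
    filter_upwards [hae] with w hw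
    have e : perp w u = perp (-w) (∑ i, (a i * act (-w) (x i)) • x i) +
        perp w (∑ i, (a i * act w (x i)) • x i) := by
      rw [← neg_one_smul ℝ w, perp_smul (by norm_num), ← perp_add, ← Finset.sum_add_distrib, hu]
      congr 1
      refine Finset.sum_congr rfl fun i _ => ?_
      rw [← add_smul, ← mul_add, neg_one_smul, act_neg_add_act (hw i), mul_one]
    simp only [hF]
    rw [e]
    set p := perp (-w) (∑ i, (a i * act (-w) (x i)) • x i)
    set q := perp w (∑ i, (a i * act w (x i)) • x i)
    have := norm_add_le p q
    have h2 : ‖p + q‖ ^ 2 ≤ (‖p‖ + ‖q‖) ^ 2 := pow_le_pow_left₀ (norm_nonneg _) this 2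
    nlinarith [sq_nonneg (‖p‖ - ‖q‖)]
  have hPi : Integrable (fun w => ‖perp w u‖ ^ 2) (stdGaussian (Vec d)) := by
    simp only [norm_perp_sq]
    exact (integrable_const _).sub (integrable_sq_inner_div_norm u)
  have h1 := integral_mono_ae (hPi.const_mul (1 / 2)) (hFn.add hFi) hpt
  simp only [Pi.add_apply] at h1
  rw [integral_const_mul, integral_add hFn hFi, hneg] at h1
  -- Projecting away a random direction loses on average at most `1/d ≤ 1/2` of the squared norm.
  -- With the factor `1/2` in `hpt` and the two copies of `F`, this gives `1/8`.
  have h2 : 1 / 2 * ‖u‖ ^ 2 ≤ ∫ w, ‖perp w u‖ ^ 2 ∂(stdGaussian (Vec d)) := by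
    simp only [norm_perp_sq]
    rw [integral_sub (integrable_const _) (integrable_sq_inner_div_norm u)]
    have h3 := integral_sq_inner_div_norm_le (by omega : 0 < d) u
    have h4 : ‖u‖ ^ 2 / d ≤ ‖u‖ ^ 2 / 2 := by
      gcongr
      exact_mod_cast hd
    simp
    linarith
  rw [inner_op_gramVInf hα x hx]
  linarith

lemma sum_norm_sq_le_specNorm (hd : 2 ≤ d) (hα : 0 < α) (x : Fin n → Vec d)
    (hx : ∀ i, ‖x i‖ ≤ 1) (hx0 : ∀ i, x i ≠ 0) :
    ∑ i, ‖x i‖ ^ 2 ≤ 8 * d * specNorm (gramVInf α x) := by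
  have hS : 0 ≤ specNorm (gramVInf α x) := norm_nonneg _
  have hl : ∀ l : Fin d, ∑ i, (x i l) ^ 2 ≤ 8 * specNorm (gramVInf α x) := fun l => by
    -- Tested on the `l`-th coordinates of the data, `∑ a_i x_i` has `l`-th coordinate `‖a‖²`, so
    -- `‖a‖⁴ / 8 ≤ S ‖a‖²`, where `S` is the spectral norm. Summing over `l` gives the factor `d`.
    set a : EuclideanSpace ℝ (Fin n) := WithLp.toLp 2 fun i => x i l with ha
    have h1 := norm_sum_sq_le_inner_op_gramVInf hd hα x hx hx0 a
    have h2 := inner_op_le_specNorm (gramVInf α x) a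
    have h3 : ‖a‖ ^ 2 = ∑ i, (x i l) ^ 2 := by
      simp [EuclideanSpace.norm_sq_eq, ha]
    have h4 : ‖a‖ ^ 2 ≤ ‖∑ i, a i • x i‖ := by
      have h5 := PiLp.norm_apply_le (∑ i, a i • x i) l
      refine le_trans ?_ h5
      rw [h3, Real.norm_eq_abs]
      refine le_trans (le_of_eq ?_) (le_abs_self _)
      simp [ha, sq]
    have h6 : (‖a‖ ^ 2) ^ 2 ≤ ‖∑ i, a i • x i‖ ^ 2 := pow_le_pow_left₀ (by positivity) h4 2
    rw [← h3]
    rcases (sq_nonneg ‖a‖).eq_or_lt with h | h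
    · rw [← h]; positivity
    · refine le_of_mul_le_mul_right ?_ h
      nlinarith
  calc _ = ∑ l, ∑ i, (x i l) ^ 2 := by
        rw [Finset.sum_comm]
        exact Finset.sum_congr rfl fun i _ => by simp [EuclideanSpace.norm_sq_eq]
    _ ≤ ∑ _l : Fin d, 8 * specNorm (gramVInf α x) := Finset.sum_le_sum fun l _ => hl l
    _ = _ := by simp; ring

lemma lambdaMin_gramVInf_le_one (hn : 0 < n) (hα : 0 < α) (x : Fin n → Vec d)
    (hx : ∀ i, ‖x i‖ ≤ 1) : lambdaMin (gramVInf α x) ≤ 1 := by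
  refine (lambdaMin_le_diag (gramVInf_symm x) ⟨0, hn⟩).trans ?_
  rw [gramVInf_apply hα]
  have := norm_integral_le_of_norm_le_const (μ := stdGaussian (Vec d)) (C := 1)
    (f := fun w => inner ℝ (perp w (x ⟨0, hn⟩)) (perp w (x ⟨0, hn⟩)) * act w (x ⟨0, hn⟩) *
      act w (x ⟨0, hn⟩))
    (Filter.Eventually.of_forall fun w => abs_gramVInf_integrand_le hx ⟨0, hn⟩ ⟨0, hn⟩ w)
  simp only [probReal_univ, mul_one] at this
  exact (le_abs_self _).trans this

instance : (stdGaussian (Vec d)).IsOpenPosMeasure := by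
  have : (gaussianReal 0 1).IsOpenPosMeasure :=
    (gaussianReal_absolutelyContinuous' 0 one_ne_zero).isOpenPosMeasure
  rw [← map_pi_eq_stdGaussian]
  exact (PiLp.continuous_toLp 2 _).isOpenPosMeasure_map (WithLp.toLp_surjective 2)

/-- If a fixed vector is almost everywhere parallel to the point on a nonempty open set, it
vanishes. -/
lemma eq_zero_of_perp_eq_zero (hd : 2 ≤ d) {O : Set (Vec d)} (hO : IsOpen O) (hne : O.Nonempty)
    {u : Vec d} (h : ∀ᵐ w ∂(stdGaussian (Vec d)), w ∈ O → perp w u = 0) : u = 0 := by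
  by_contra hu
  have hproper : (ℝ ∙ u) ≠ ⊤ := fun htop => by
    have h1 := finrank_span_singleton (K := ℝ) hu
    rw [htop, finrank_top, finrank_euclideanSpace_fin] at h1
    omega
  -- For `d ≥ 2` a line has empty interior, so a nonempty open set of points not parallel to `u`
  -- remains, and it has positive Gaussian measure.
  have hO' : IsOpen (O \ (ℝ ∙ u : Submodule ℝ (Vec d))) :=
    hO.sdiff (Submodule.closed_of_finiteDimensional _)
  have hne' : (O \ (ℝ ∙ u : Submodule ℝ (Vec d))).Nonempty := by
    by_contra hemp
    rw [Set.not_nonempty_iff_eq_empty, Set.sdiff_eq_empty] at hemp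
    refine hproper (Submodule.eq_top_of_nonempty_interior' _ ?_)
    exact (hne.mono (hO.subset_interior_iff.2 hemp))
  have hpos := hO'.measure_pos (stdGaussian (Vec d)) hne'
  refine hpos.ne' (measure_mono_null ?_ (ae_iff.1 h))
  rintro w ⟨hw, hwu⟩ hcon
  have hp := hcon hw
  unfold perp at hp
  rw [sub_eq_zero] at hp
  apply hwu
  obtain ⟨b, hb⟩ : ∃ b : ℝ, u = b • w := ⟨_, hp⟩
  have hb0 : b ≠ 0 := fun h0 => hu (by rw [hb, h0, zero_smul])
  rw [SetLike.mem_coe, Submodule.mem_span_singleton]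
  exact ⟨b⁻¹, by rw [hb, smul_smul, inv_mul_cancel₀ hb0, one_smul]⟩

/-- No other `x j` vanishes identically on the hyperplane orthogonal to `x i`, as it would otherwise
be parallel to `x i`. Finitely many nonzero functionals have a common point at which none vanishes.
-/
lemma exists_orthogonal_generic (x : Fin n → Vec d)
    (hx0 : ∀ i, x i ≠ 0) (hpar : ∀ i j, i ≠ j → ∀ β : ℝ, β ≠ 0 → x i ≠ β • x j) (i : Fin n) :
    ∃ p : Vec d, inner ℝ p (x i) = 0 ∧ ∀ j, j ≠ i → inner ℝ p (x j) ≠ 0 := by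
  have hex : ∀ j : {j : Fin n // j ≠ i}, ∃ z ∈ (ℝ ∙ x i)ᗮ,
      (innerSL ℝ (x j) : Vec d →L[ℝ] ℝ).toLinearMap z ≠ 0 := by
    rintro ⟨j, hj⟩
    by_contra hcon
    push Not at hcon
    have hmem : x j ∈ (ℝ ∙ x i)ᗮᗮ := by
      rw [Submodule.mem_orthogonal]
      intro z hz
      rw [real_inner_comm]
      exact hcon z hz
    rw [Submodule.orthogonal_orthogonal, Submodule.mem_span_singleton] at hmem
    obtain ⟨b, hb⟩ := hmem
    refine hpar j i hj b ?_ hb.symm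
    rintro rfl
    exact hx0 j (by rw [← hb, zero_smul])
  obtain ⟨p, hp, hp'⟩ := Module.Dual.exists_forall_mem_ne_zero_of_forall_exists _ _ hex
  refine ⟨p, ?_, fun j hj => ?_⟩
  · rw [real_inner_comm]
    exact Submodule.mem_orthogonal_singleton_iff_inner_right.1 hp
  · rw [real_inner_comm]
    exact hp' ⟨j, hj⟩

/-- For a null vector `a` the active sum is almost surely parallel to `w`. Near a generic point of
the hyperplane orthogonal to `x i` the active sum takes only two values, `a i • x i + U` and `U`,
one on each side. Both are fixed vectors parallel to almost every nearby `w`, so both vanish and `a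
i = 0`. -/
lemma lambdaMin_gramVInf_pos (hd : 2 ≤ d) (hn : 0 < n) (hα : 0 < α) (x : Fin n → Vec d)
    (hx : ∀ i, ‖x i‖ ≤ 1) (hx0 : ∀ i, x i ≠ 0)
    (hpar : ∀ i j, i ≠ j → ∀ β : ℝ, β ≠ 0 → x i ≠ β • x j) :
    0 < lambdaMin (gramVInf α x) := by
  obtain ⟨a, ha, he⟩ := exists_eigenvector_lambdaMin hn (gramVInf_symm (α := α) x)
  have hval : inner ℝ a (op (gramVInf α x) a) = lambdaMin (gramVInf α x) := by
    rw [he, real_inner_smul_right, real_inner_self_eq_norm_sq, ha]; ring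
  rw [inner_op_gramVInf hα x hx] at hval
  have h0 : 0 ≤ lambdaMin (gramVInf α x) := by
    rw [← hval]; exact integral_nonneg fun w => by positivity
  refine h0.lt_of_ne fun hzero => ?_
  rw [← hzero, integral_eq_zero_iff_of_nonneg (fun w => by positivity)
    (integrable_sum_act_perp x hx a)] at hval
  have hae : ∀ᵐ w ∂(stdGaussian (Vec d)), perp w (∑ i, (a i * act w (x i)) • x i) = 0 := by
    filter_upwards [hval] with w hw
    simpa using hw
  have hcoord : ∀ i, a i = 0 := fun i => by
    obtain ⟨p, hp, hp'⟩ := exists_orthogonal_generic x hx0 hpar i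
    -- near `p` only the activation of `x i` changes
    set O : Set (Vec d) := ⋂ j ∈ Finset.univ.filter (· ≠ i),
      {w | 0 < inner ℝ w (x j) * inner ℝ p (x j)} with hO
    have hOo : IsOpen O := isOpen_biInter_finset fun j _ =>
      isOpen_lt continuous_const (by fun_prop)
    have hpO : p ∈ O := by
      simp only [hO, Set.mem_iInter, Finset.mem_filter, Finset.mem_univ, true_and]
      exact fun j hj => mul_self_pos.2 (hp' j hj)
    have hact : ∀ w ∈ O, ∀ j, j ≠ i → act w (x j) = act p (x j) := fun w hw j hj => by
      simp only [hO, Set.mem_iInter, Finset.mem_filter, Finset.mem_univ, true_and] at hw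
      have := hw j hj
      unfold act
      simp only [Set.mem_ofPred_eq] at this
      rcases pos_and_pos_or_neg_and_neg_of_mul_pos this with ⟨h1, h2⟩ | ⟨h1, h2⟩
      · simp [h1.le, h2.le]
      · simp [not_le.2 h1, not_le.2 h2]
    set U := ∑ j ∈ Finset.univ.erase i, (a j * act p (x j)) • x j with hU
    have hsplit : ∀ w ∈ O, ∑ j, (a j * act w (x j)) • x j = (a i * act w (x i)) • x i + U :=
      fun w hw => by
        rw [← Finset.add_sum_erase _ _ (Finset.mem_univ i), hU]
        congr 1
        refine Finset.sum_congr rfl fun j hj => ?_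
        rw [hact w hw j (Finset.ne_of_mem_erase hj)]
    have hnei : ∀ s : ℝ, s ≠ 0 → (O ∩ {w | 0 < s * inner ℝ w (x i)}).Nonempty := fun s hs => by
      have hcont : Filter.Tendsto (fun t : ℝ => p + (t * s) • x i) (nhdsWithin 0 (Set.Ioi 0))
          (nhds p) := by
        have : Continuous fun t : ℝ => p + (t * s) • x i := by fun_prop
        have h := this.tendsto 0
        simp only [zero_mul, zero_smul, add_zero] at h
        exact h.mono_left nhdsWithin_le_nhds
      have hev := hcont.eventually (hOo.mem_nhds hpO)
      obtain ⟨t, ht, ht0⟩ := (hev.and self_mem_nhdsWithin).exists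
      refine ⟨_, ht, ?_⟩
      simp only [Set.mem_ofPred_eq, inner_add_left, hp, real_inner_smul_left,
        real_inner_self_eq_norm_sq, zero_add]
      have h1 : 0 < ‖x i‖ := norm_pos_iff.2 (hx0 i)
      have h2 : 0 < s ^ 2 := by positivity
      have h3 : (0 : ℝ) < t := ht0
      calc (0 : ℝ) < t * s ^ 2 * ‖x i‖ ^ 2 := by positivity
        _ = _ := by ring
    have hplus : a i • x i + U = 0 := by
      refine eq_zero_of_perp_eq_zero hd (hOo.inter (isOpen_lt continuous_const (by fun_prop)))
        (hnei 1 one_ne_zero) ?_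
      filter_upwards [hae] with w hw hwO
      rw [hsplit w hwO.1] at hw
      have h1 : 0 < 1 * inner ℝ w (x i) := hwO.2
      rw [one_mul] at h1
      simpa [act, h1.le] using hw
    have hminus : U = 0 := by
      refine eq_zero_of_perp_eq_zero hd (hOo.inter (isOpen_lt continuous_const (by fun_prop)))
        (hnei (-1) (by norm_num)) ?_
      filter_upwards [hae] with w hw hwO
      rw [hsplit w hwO.1] at hw
      have h1 : 0 < -1 * inner ℝ w (x i) := hwO.2
      have h2 : ¬ 0 ≤ inner ℝ w (x i) := by linarith
      simpa [act, h2] using hw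
    rw [hminus, add_zero] at hplus
    exact (smul_eq_zero.1 hplus).resolve_right (hx0 i)
  have : a = 0 := by ext i; exact hcoord i
  rw [this, norm_zero] at ha
  exact zero_ne_one ha

end GramVInf
-- High probability of a good initialization.
section GoodEvent
variable {d n m : ℕ}

lemma rademacher_ae_sq : ∀ᵐ c ∂rademacher, c ^ 2 = 1 := by
  unfold rademacher
  refine Measure.ae_smul_measure ?_ _
  rw [ae_add_measure_iff, ae_dirac_iff (by measurability), ae_dirac_iff (by measurability)]
  norm_num

lemma integral_fst_prod_rademacher (f : Vec d → ℝ) :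
    ∫ p, f p.1 ∂((stdGaussian (Vec d)).prod rademacher) = ∫ w, f w ∂(stdGaussian (Vec d)) := by
  rw [integral_fun_fst]
  simp

lemma measurable_relu : Measurable relu := measurable_id.max measurable_const

/-- Deviation bound for empirical averages over the initial directions. -/
lemma baseLaw_deviation_le {f : Vec d → ℝ} (hf : Measurable f) (hb : ∀ w, |f w| ≤ 1)
    (hm : 0 < m) {t q : ℝ} (ht : 0 ≤ t) (hq : q ≤ m * t ^ 2 / 2) :
    baseLaw m d {ω | t < |(1 / (m : ℝ)) * ∑ k, f (ω k).1 -
      ∫ w, f w ∂(stdGaussian (Vec d))|} ≤ ENNReal.ofReal (2 * Real.exp (-q)) := by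
  rw [← integral_fst_prod_rademacher]
  refine (pi_abs_avg_sub_integral_gt_le (hf.comp measurable_fst) (fun p => hb p.1) hm ht).trans ?_
  exact ENNReal.ofReal_le_ofReal (by gcongr)

lemma baseLaw_exists_norm_le (hd : 0 < d) {r : ℝ} (hr : 0 < r) :
    baseLaw m d {ω | ∃ k, ‖(ω k).1‖ ≤ r} ≤
      ENNReal.ofReal (m * (√(Real.exp 1 / d) * r) ^ d) := by
  have h1 : ∀ k : Fin m, baseLaw m d {ω | ‖(ω k).1‖ ≤ r} ≤
      ENNReal.ofReal ((√(Real.exp 1 / d) * r) ^ d) := fun k => by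
    have hmp : MeasurePreserving (fun ω : Fin m → Vec d × ℝ => (ω k).1) (baseLaw m d)
        (stdGaussian (Vec d)) :=
      measurePreserving_fst.comp (measurePreserving_eval _ k)
    have hms : MeasurableSet {w : Vec d | ‖w‖ ≤ r} :=
      measurableSet_le measurable_norm measurable_const
    have := hmp.measure_preimage hms.nullMeasurableSet
    change baseLaw m d ((fun ω : Fin m → Vec d × ℝ => (ω k).1) ⁻¹' {w : Vec d | ‖w‖ ≤ r}) ≤ _
    rw [this, ← ofReal_measureReal]
    exact ENNReal.ofReal_le_ofReal (measureReal_norm_le_le hd hr)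
  have e : {ω : Fin m → Vec d × ℝ | ∃ k, ‖(ω k).1‖ ≤ r} = ⋃ k, {ω | ‖(ω k).1‖ ≤ r} := by
    ext ω; simp
  rw [e]
  refine (measure_iUnion_fintype_le _ _).trans ((Finset.sum_le_sum fun k _ => h1 k).trans ?_)
  rw [Finset.sum_const, Finset.card_univ, Fintype.card_fin, nsmul_eq_mul,
    ENNReal.ofReal_mul (by positivity), ENNReal.ofReal_natCast]

/-- The initial lengths cancel the normalization, leaving a plain ReLU network; the form `√m` times
an average suits the sub-Gaussian bound. -/
lemma pred_init_eq {c : Fin m → ℝ} {w₀ : Fin m → Vec d} (h0 : ∀ k, 0 < ‖w₀ k‖)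
    (x : Fin n → Vec d) (i : Fin n) :
    pred c x ⟨w₀, fun k => ‖w₀ k‖⟩ i =
      √(m : ℝ) * ((1 / (m : ℝ)) * ∑ k, c k * relu (inner ℝ (w₀ k) (x i))) := by
  simp only [pred, net]
  have : ∀ k, ‖w₀ k‖ * (inner ℝ (w₀ k) (x i) / ‖w₀ k‖) = inner ℝ (w₀ k) (x i) := fun k => by
    have := (h0 k).ne'
    field_simp
  simp only [this]
  rw [← mul_assoc]
  congr 1
  rw [mul_one_div, Real.sqrt_div_self, one_div]

/-- The random initialization is good with high probability. -/
lemma baseLaw_not_good_le (hd : 3 ≤ d) (hm : 0 < m) (hn : 0 < n) {α : ℝ} (hα : 0 < α)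
    (x : Fin n → Vec d) (hx : ∀ i, ‖x i‖ ≤ 1) (hx0 : ∀ i, x i ≠ 0) {R τ u q : ℝ} (hR : 0 < R)
    (hRτ : 8 * R ≤ τ) (hu : 0 ≤ u) (hq : q ≤ m * τ ^ 2 / 8) (hqu : q ≤ u ^ 2 / 2) :
    baseLaw m d {ω | ¬ (GoodInit x (fun k => (ω k).2) (fun k => (ω k).1) (gramVInf α x) R τ
        ((∑ i, ‖x i‖ ^ 2) / d + n * τ) ∧
      ∀ i, |pred (fun k => (ω k).2) x ⟨fun k => (ω k).1, fun k => ‖(ω k).1‖⟩ i| ≤ u)} ≤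
      ENNReal.ofReal (m * (√(Real.exp 1 / d) * (4 * R)) ^ d + 10 * n ^ 2 * Real.exp (-q)) := by
  have hm0 : (0 : ℝ) < m := by exact_mod_cast hm
  have hτ : 0 < τ := by linarith
  set e : ℝ≥0∞ := ENNReal.ofReal (2 * Real.exp (-q)) with he
  have hq2 : q ≤ m * (τ / 2) ^ 2 / 2 := by linarith [show m * (τ / 2) ^ 2 / 2 = m * τ ^ 2 / 8 by ring]
  have hq1 : q ≤ m * τ ^ 2 / 2 := by nlinarith [sq_nonneg τ, mul_nonneg hm0.le (sq_nonneg τ)]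
  set B₀ : Set (Fin m → Vec d × ℝ) := {ω | ¬ ∀ k, (ω k).2 ^ 2 = 1}
  set B₁ : Set (Fin m → Vec d × ℝ) := {ω | ∃ k, ‖(ω k).1‖ ≤ 4 * R}
  -- The truncation by `1` makes Hoeffding's inequality applicable; outside `B₁` it is inactive. The
  -- other half of `τ` absorbs the mean, which is at most `4 R ≤ τ / 2`.
  set B₂ : Set (Fin m → Vec d × ℝ) := {ω | τ / 2 < |(1 / (m : ℝ)) * ∑ k, min 1 (R / ‖(ω k).1‖) -
      ∫ w, min 1 (R / ‖w‖) ∂(stdGaussian (Vec d))|}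
  set B₃ : Fin n → Set (Fin m → Vec d × ℝ) := fun i => {ω | τ / 2 <
      |(1 / (m : ℝ)) * ∑ k, nearKink R (ω k).1 (x i) -
        ∫ w, nearKink R w (x i) ∂(stdGaussian (Vec d))|}
  set B₄ : Fin n → Fin n → Set (Fin m → Vec d × ℝ) := fun i j => {ω | τ <
      |(1 / (m : ℝ)) * ∑ k, inner ℝ (perp (ω k).1 (x i)) (perp (ω k).1 (x j)) *
        act (ω k).1 (x i) * act (ω k).1 (x j) -
        ∫ w, inner ℝ (perp w (x i)) (perp w (x j)) * act w (x i) * act w (x j)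
          ∂(stdGaussian (Vec d))|}
  set B₅ : Fin n → Set (Fin m → Vec d × ℝ) := fun i => {ω | τ <
      |(1 / (m : ℝ)) * ∑ k, (relu (inner ℝ (ω k).1 (x i)) / ‖(ω k).1‖) ^ 2 -
        ∫ w, (relu (inner ℝ w (x i)) / ‖w‖) ^ 2 ∂(stdGaussian (Vec d))|}
  set B₆ : Fin n → Set (Fin m → Vec d × ℝ) := fun i => {ω | u / √(m : ℝ) <
      |(1 / (m : ℝ)) * ∑ k, (ω k).2 * relu (inner ℝ (ω k).1 (x i))|}
  have hsub : {ω | ¬ (GoodInit x (fun k => (ω k).2) (fun k => (ω k).1) (gramVInf α x) R τ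
        ((∑ i, ‖x i‖ ^ 2) / d + n * τ) ∧
      ∀ i, |pred (fun k => (ω k).2) x ⟨fun k => (ω k).1, fun k => ‖(ω k).1‖⟩ i| ≤ u)} ⊆
      B₀ ∪ (B₁ ∪ (B₂ ∪ ((⋃ i, B₃ i) ∪ ((⋃ i, ⋃ j, B₄ i j) ∪ ((⋃ i, B₅ i) ∪ ⋃ i, B₆ i))))) := by
    intro ω hω
    by_contra hcon
    simp only [Set.mem_union, Set.mem_iUnion, not_or, not_exists] at hcon
    obtain ⟨h0, h1, h2, h3, h4, h5, h6⟩ := hcon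
    simp only [B₀, B₁, B₂, B₃, B₄, B₅, B₆, Set.mem_ofPred_eq, not_not, not_exists, not_le,
      not_lt] at h0 h1 h2 h3 h4 h5 h6
    have hpos : ∀ k, 0 < ‖(ω k).1‖ := fun k => by linarith [h1 k]
    have hmin : ∀ k, min 1 (R / ‖(ω k).1‖) = R / ‖(ω k).1‖ := fun k => by
      refine min_eq_right ((div_le_one (hpos k)).2 ?_)
      linarith [h1 k]
    simp only [hmin] at h2
    refine hω ⟨⟨hm, hx, h0, hpos, fun k => (h1 k).le, ?_, fun i => ?_, fun i j => ?_, ?_⟩,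
      fun i => ?_⟩
    · linarith [(abs_le.1 h2).2, integral_min_div_norm_le hd hR.le]
    · linarith [(abs_le.1 (h3 i)).2, integral_nearKink_le (hx0 i) hR.le]
    · rw [gramV_init_apply h0 hpos, gramVInf_apply hα]
      exact h4 i j
    · have h7 : ∀ i, gramG x ⟨fun k => (ω k).1, fun k => ‖(ω k).1‖⟩ i i ≤
          ‖x i‖ ^ 2 / d + τ := fun i => by
        have h8 : ∫ w, (relu (inner ℝ w (x i)) / ‖w‖) ^ 2 ∂(stdGaussian (Vec d)) ≤
            ‖x i‖ ^ 2 / d := by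
          refine le_trans (integral_mono_of_nonneg
            (Filter.Eventually.of_forall fun w => by positivity)
            (integrable_sq_inner_div_norm (x i)) (Filter.Eventually.of_forall fun w => ?_))
            (integral_sq_inner_div_norm_le (by omega) (x i))
          simp only
          rw [← relu_div (norm_nonneg _), ← sq_abs (inner ℝ w (x i) / ‖w‖)]
          exact pow_le_pow_left₀ (relu_nonneg _) ((le_abs_self _).trans (abs_relu_le _)) 2
        rw [gramG_eq]
        simp only [← sq]
        linarith [(abs_le.1 (h5 i)).2]
      refine (Finset.sum_le_sum fun i _ => h7 i).trans (le_of_eq ?_)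
      rw [Finset.sum_add_distrib, ← Finset.sum_div]
      simp
    · rw [pred_init_eq hpos, abs_mul, abs_of_nonneg (Real.sqrt_nonneg _)]
      have := h6 i
      rw [le_div_iff₀ (Real.sqrt_pos.2 hm0)] at this
      linarith
  have b0 : baseLaw m d B₀ = 0 := by
    rw [← ae_iff (p := fun ω : Fin m → Vec d × ℝ => ∀ k, (ω k).2 ^ 2 = 1), ae_all_iff]
    intro k
    have hmp : MeasurePreserving (fun ω : Fin m → Vec d × ℝ => (ω k).2) (baseLaw m d)
        rademacher := measurePreserving_snd.comp (measurePreserving_eval _ k)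
    exact hmp.quasiMeasurePreserving.ae rademacher_ae_sq
  have b1 := baseLaw_exists_norm_le (m := m) (by omega : 0 < d) (by linarith : 0 < 4 * R)
  have b2 : baseLaw m d B₂ ≤ e := by
    refine baseLaw_deviation_le (f := fun w => min 1 (R / ‖w‖)) (by fun_prop) (fun w => ?_) hm
      (by positivity) hq2
    rw [abs_of_nonneg (by positivity)]
    exact min_le_left _ _
  have b3 : ∀ i, baseLaw m d (B₃ i) ≤ e := fun i =>
    baseLaw_deviation_le (f := fun w => nearKink R w (x i)) (measurable_nearKink R (x i))
      (fun w => by rw [abs_of_nonneg (nearKink_nonneg _ _ _)]; exact nearKink_le_one _ _ _) hm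
      (by positivity) hq2
  have b4 : ∀ i j, baseLaw m d (B₄ i j) ≤ e := fun i j =>
    baseLaw_deviation_le (f := fun w => inner ℝ (perp w (x i)) (perp w (x j)) * act w (x i) *
      act w (x j)) (measurable_gramVInf_integrand x i j) (abs_gramVInf_integrand_le hx i j) hm
      hτ.le hq1
  have b5 : ∀ i, baseLaw m d (B₅ i) ≤ e := fun i => by
    refine baseLaw_deviation_le (f := fun w => (relu (inner ℝ w (x i)) / ‖w‖) ^ 2)
      (((measurable_relu.comp (by fun_prop)).div measurable_norm).pow_const 2) (fun w => ?_) hm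
      hτ.le hq1
    have h9 : 0 ≤ relu (inner ℝ w (x i)) / ‖w‖ := div_nonneg (relu_nonneg _) (norm_nonneg _)
    rw [abs_of_nonneg (by positivity)]
    exact pow_le_one₀ h9 ((relu_inner_div_norm_le w (x i)).trans (hx i))
  have b6 : ∀ i, baseLaw m d (B₆ i) ≤ e := fun i => by
    refine (pi_abs_avg_gt_le (hasSubgaussianMGF_sign_mul_relu (hx i)) hm
      (by positivity : 0 ≤ u / √(m : ℝ))).trans (ENNReal.ofReal_le_ofReal ?_)
    have : (m : ℝ) * (u / √(m : ℝ)) ^ 2 / 2 = u ^ 2 / 2 := by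
      rw [div_pow, Real.sq_sqrt hm0.le]
      field_simp
    rw [this]
    gcongr
  have hU : ∀ {B : Fin n → Set (Fin m → Vec d × ℝ)} {b : ℝ≥0∞}, (∀ i, baseLaw m d (B i) ≤ b) →
      baseLaw m d (⋃ i, B i) ≤ n * b := fun {B b} hB => by
    refine (measure_iUnion_fintype_le _ _).trans ((Finset.sum_le_sum fun i _ => hB i).trans ?_)
    simp
  have hun : ∀ {A B : Set (Fin m → Vec d × ℝ)} {a b : ℝ≥0∞}, baseLaw m d A ≤ a →
      baseLaw m d B ≤ b → baseLaw m d (A ∪ B) ≤ a + b := fun ha hb =>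
    (measure_union_le _ _).trans (add_le_add ha hb)
  refine (measure_mono hsub).trans ((hun b0.le (hun b1 (hun b2 (hun (hU b3) (hun
    (hU fun i => hU (b4 i)) (hun (hU b5) (hU b6))))))).trans ?_)
  rw [zero_add, ENNReal.ofReal_add (by positivity) (by positivity)]
  gcongr
  have h1n : (1 : ℝ) ≤ n := by exact_mod_cast hn
  rw [he, ← ENNReal.ofReal_natCast n]
  simp only [← ENNReal.ofReal_mul (Nat.cast_nonneg (α := ℝ) n)]
  rw [← ENNReal.ofReal_add (by positivity) (by positivity),
    ← ENNReal.ofReal_add (by positivity) (by positivity),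
    ← ENNReal.ofReal_add (by positivity) (by positivity),
    ← ENNReal.ofReal_add (by positivity) (by positivity)]
  refine ENNReal.ofReal_le_ofReal ?_
  have : 0 < Real.exp (-q) := Real.exp_pos _
  -- There are `1 + n + n² + n + n` deviation events of probability at most `2 exp (-q)`, and `2 n²
  -- + 6 n + 2 ≤ 10 n²`.
  nlinarith [mul_nonneg this.le (by nlinarith : (0 : ℝ) ≤ 8 * n ^ 2 - 6 * n - 2)]

end GoodEvent
-- Arithmetic of the width condition.
section Width

/-- The radius `4 R` is so small that, by a union bound over the neurons, no initial direction has
norm at most `4 R` except with probability `δ / 2`. -/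
lemma small_ball_budget {d m : ℕ} {δ L D K C P R : ℝ} (hd : 2 ≤ d) (hm0 : (0 : ℝ) < m)
    (hδ : 0 < δ) (hD : 1 ≤ D) (hR0 : 0 < R) (hCK : 640000 * D ^ 4 * |K| ^ 5 ≤ C) (hC0 : 0 < C)
    (hm : C * P ≤ m) (hP0 : 0 ≤ P) (hLm : L ≤ Real.log (m / δ)) (hR4 : R ^ 4 * (m * m) = D ^ 4 * P * L)
    (hK : ((m : ℝ) / δ) ^ ((1 : ℝ) / (d : ℝ)) ≤ K * (m : ℝ) ^ ((1 : ℝ) / 5)) :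
    m * (√(Real.exp 1 / d) * (4 * R)) ^ d ≤ δ / 2 := by
  have hd0 : (0 : ℝ) < d := by positivity
  set X : ℝ := ((m : ℝ) / δ) ^ ((1 : ℝ) / (d : ℝ)) with hX
  have hX0 : 0 < X := by positivity
  have hXd : X ^ d = m / δ := by
    rw [hX, one_div]
    exact Real.rpow_inv_natCast_pow (by positivity) (by omega)
  have hm5 : ((m : ℝ) ^ ((1 : ℝ) / 5)) ^ 5 = m := by
    have := Real.rpow_inv_natCast_pow hm0.le (by norm_num : (5 : ℕ) ≠ 0)
    simpa [one_div] using this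
  have hX5 : X ^ 5 ≤ |K| ^ 5 * m := by
    calc X ^ 5 ≤ (|K| * (m : ℝ) ^ ((1 : ℝ) / 5)) ^ 5 := by
          refine pow_le_pow_left₀ hX0.le (hK.trans ?_) 5
          gcongr
          exact le_abs_self K
      _ = |K| ^ 5 * m := by rw [mul_pow, hm5]
  have hLX : L ≤ d * X := by
    calc L ≤ Real.log (m / δ) := hLm
      _ = d * Real.log X := by rw [← hXd, Real.log_pow]
      _ ≤ d * X := by gcongr; exact Real.log_le_self hX0.le
  have hCR : C * R ^ 4 * m ≤ D ^ 4 * (d * X) := by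
    have h1 : C * R ^ 4 * m * m ≤ D ^ 4 * (d * X) * m := by
      calc C * R ^ 4 * m * m = D ^ 4 * L * (C * P) := by linear_combination C * hR4
        _ ≤ D ^ 4 * (d * X) * m := by gcongr
    exact le_of_mul_le_mul_right h1 hm0
  have hRX : C * (R * X) ^ 4 ≤ D ^ 4 * d * |K| ^ 5 := by
    have h1 : C * (R * X) ^ 4 * m ≤ D ^ 4 * d * |K| ^ 5 * m := by
      calc C * (R * X) ^ 4 * m = C * R ^ 4 * m * X ^ 4 := by ring
        _ ≤ D ^ 4 * (d * X) * X ^ 4 := by gcongr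
        _ = D ^ 4 * d * X ^ 5 := by ring
        _ ≤ D ^ 4 * d * (|K| ^ 5 * m) := by gcongr
        _ = _ := by ring
    exact le_of_mul_le_mul_right h1 hm0
  have hRXd : 640000 * (R * X) ^ 4 ≤ d := by
    have hD4 : 0 < D ^ 4 := by positivity
    have hKpos : 0 < K := by
      by_contra hneg
      have : K * (m : ℝ) ^ ((1 : ℝ) / 5) ≤ 0 :=
        mul_nonpos_of_nonpos_of_nonneg (not_lt.1 hneg) (by positivity)
      linarith
    have hKK : 0 < D ^ 4 * |K| ^ 5 := by positivity
    refine le_of_mul_le_mul_left ?_ hKK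
    calc D ^ 4 * |K| ^ 5 * (640000 * (R * X) ^ 4) = 640000 * D ^ 4 * |K| ^ 5 * (R * X) ^ 4 := by
          ring
      _ ≤ C * (R * X) ^ 4 := by gcongr
      _ ≤ _ := by linarith
  -- Since `m = δ X ^ d`, the quantity to bound is `δ Y ^ d`, so `Y ≤ 1/2` suffices.
  set Y : ℝ := X * (√(Real.exp 1 / d) * (4 * R)) with hY
  have hY0 : 0 ≤ Y := by positivity
  have hY4 : Y ≤ 1 / 2 := by
    have h1 : Y ^ 4 ≤ (1 / 2) ^ 4 := by
      have e1 : √(Real.exp 1 / d) ^ 4 = (Real.exp 1 / d) ^ 2 := by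
        rw [show √(Real.exp 1 / d) ^ 4 = (√(Real.exp 1 / d) ^ 2) ^ 2 by ring,
          Real.sq_sqrt (by positivity)]
      have e2 : Y ^ 4 = 256 * (R * X) ^ 4 * (Real.exp 1 / d) ^ 2 := by
        rw [hY, mul_pow, mul_pow, e1]; ring
      have h2 : (Real.exp 1 / d) ^ 2 ≤ 9 / d := by
        rw [div_pow, div_le_div_iff₀ (by positivity) hd0]
        have h3 : Real.exp 1 ^ 2 ≤ 9 := by
          calc Real.exp 1 ^ 2 ≤ 3 ^ 2 :=
                pow_le_pow_left₀ (Real.exp_pos 1).le Real.exp_one_lt_three.le 2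
            _ = 9 := by norm_num
        have h4 : (1 : ℝ) ≤ d := by exact_mod_cast (by omega : 1 ≤ d)
        exact mul_le_mul h3 (le_self_pow₀ h4 two_ne_zero) hd0.le (by norm_num)
      rw [e2]
      calc 256 * (R * X) ^ 4 * (Real.exp 1 / d) ^ 2 ≤ 256 * (d / 640000) * (9 / d) := by
            gcongr
            linarith
        _ ≤ (1 / 2) ^ 4 := by
            field_simp
            norm_num
    exact (pow_le_pow_iff_left₀ hY0 (by norm_num) (by norm_num)).1 h1
  have hm' : (m : ℝ) = δ * X ^ d := by rw [hXd]; field_simp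
  rw [hm', mul_assoc, ← mul_pow, ← hY]
  calc δ * Y ^ d ≤ δ * (1 / 2) ^ d := by gcongr
    _ ≤ δ * (1 / 2) ^ 1 := by
        gcongr ?_ * ?_
        exact pow_le_pow_of_le_one (by norm_num) (by norm_num) (by omega)
    _ = δ / 2 := by ring

/-- The quantitative consequences of the width condition. -/
lemma width_bounds {n d m : ℕ} {lam δ L D K C : ℝ} (hn : 0 < n) (hd : 2 ≤ d) (hlam : 0 < lam)
    (hlam1 : lam ≤ 1) (hδ : 0 < δ) (hδ1 : δ < 1) (hL : L = Real.log (n / δ)) (hL2 : 1 / 2 ≤ L)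
    (hD : 1 ≤ D) (hC : C = 640000 * D ^ 4 * (1 + |K| ^ 5))
    (hK : ((m : ℝ) / δ) ^ ((1 : ℝ) / (d : ℝ)) ≤ K * (m : ℝ) ^ ((1 : ℝ) / 5))
    (hm : C * ((n : ℝ) ^ 4 * L / lam ^ 4) ≤ (m : ℝ)) :
    0 < m ∧ 8 * (D * n * √L / (√(m : ℝ) * lam)) ≤ lam / (100 * n) ∧
    8 * L ≤ m * (lam / (100 * n)) ^ 2 / 8 ∧
    m * (√(Real.exp 1 / d) * (4 * (D * n * √L / (√(m : ℝ) * lam)))) ^ d ≤ δ / 2 := by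
  have hn1 : (1 : ℝ) ≤ n := by exact_mod_cast hn
  have hL0 : 0 < L := by linarith
  set P : ℝ := (n : ℝ) ^ 4 * L / lam ^ 4 with hP
  have hP0 : 0 < P := by positivity
  have hD2 : D ^ 2 ≤ D ^ 4 := pow_le_pow_right₀ hD (by norm_num)
  have hD1 : 1 ≤ D ^ 2 := one_le_pow₀ hD
  have hK5 : 0 ≤ |K| ^ 5 := by positivity
  have hC2 : 640000 * D ^ 2 ≤ C := by rw [hC]; nlinarith
  have hCK : 640000 * D ^ 4 * |K| ^ 5 ≤ C := by
    rw [hC]; nlinarith [pow_pos (by linarith : 0 < D) 4]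
  have hC0 : 0 < C := by linarith
  have hm0 : (0 : ℝ) < m := lt_of_lt_of_le (by positivity) hm
  have hsm : 0 < √(m : ℝ) := Real.sqrt_pos.2 hm0
  have hm2 : 640000 * D ^ 2 * P ≤ m := le_trans (by gcongr) hm
  have hn4 : (n : ℝ) ≤ (n : ℝ) ^ 4 := le_self_pow₀ hn1 (by norm_num)
  have hPn : (n : ℝ) ^ 4 * L ≤ P := by
    rw [hP, le_div_iff₀ (by positivity)]
    exact mul_le_of_le_one_right (by positivity) (pow_le_one₀ hlam.le hlam1)
  have hnm : (n : ℝ) ≤ m := by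
    have : (n : ℝ) ^ 4 * (1 / 2) ≤ (n : ℝ) ^ 4 * L := by gcongr
    nlinarith
  set R : ℝ := D * n * √L / (√(m : ℝ) * lam) with hR
  have hR0 : 0 < R := by positivity
  refine ⟨by exact_mod_cast hm0, ?_, ?_, ?_⟩
  -- This is `8 R ≤ τ` solved for `√m`; it needs `m ≥ 800² D² n⁴ L / lam⁴`, the source of both the
  -- rate in the width condition and the constant `640000`.
  · have h1 : 800 * D * n ^ 2 * √L / lam ^ 2 ≤ √(m : ℝ) := by
      refine Real.le_sqrt_of_sq_le (le_trans (le_of_eq ?_) hm2)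
      rw [div_pow, mul_pow, Real.sq_sqrt hL0.le, hP]
      field_simp
      ring
    rw [div_le_iff₀ (by positivity)] at h1
    rw [hR, mul_div_assoc', div_le_div_iff₀ (by positivity) (by positivity)]
    nlinarith
  · have h2 : 640000 * (n ^ 2 * L / lam ^ 2) ≤ m := by
      refine le_trans ?_ hm2
      have h3 : n ^ 2 * L / lam ^ 2 ≤ P := by
        rw [hP, div_le_div_iff₀ (by positivity) (by positivity)]
        have h4 : lam ^ 4 ≤ lam ^ 2 := pow_le_pow_of_le_one hlam.le hlam1 (by norm_num)
        have h5 : (n : ℝ) ^ 2 ≤ (n : ℝ) ^ 4 := pow_le_pow_right₀ hn1 (by norm_num)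
        gcongr
      nlinarith
    rw [mul_div_assoc', div_le_iff₀ (by positivity)] at h2
    rw [div_pow, mul_div_assoc', le_div_iff₀ (by positivity), le_div_iff₀ (by positivity)]
    nlinarith
  · have hLm : L ≤ Real.log (m / δ) := by rw [hL]; gcongr
    have hR4 : R ^ 4 * (m * m) = D ^ 4 * P * L := by
      have e1 : √L ^ 4 = L ^ 2 := by
        rw [show √L ^ 4 = (√L ^ 2) ^ 2 by ring, Real.sq_sqrt hL0.le]
      have e2 : √(m : ℝ) ^ 4 = m * m := by
        rw [show √(m : ℝ) ^ 4 = (√(m : ℝ) ^ 2) ^ 2 by ring, Real.sq_sqrt hm0.le, sq]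
      rw [hR, hP, div_pow, mul_pow, mul_pow, mul_pow, e1, e2]
      field_simp
    exact small_ball_budget hd hm0 hδ hD hR0 hCK hC0 hm hP0.le hLm hR4 hK

/-- With `q = 8 L` each exponential is `(δ / n) ^ 8`: two powers cancel `n²`, and the other six are
at most `2⁻⁶` because `δ / n ≤ 1/2`. -/
lemma ten_mul_sq_mul_exp_le {n : ℕ} {δ : ℝ} (hn : 0 < n) (hδ : 0 < δ) (hδ1 : δ < 1)
    (hδn : 2 * δ ≤ n) : 10 * (n : ℝ) ^ 2 * Real.exp (-(8 * Real.log (n / δ))) ≤ δ / 2 := by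
  have hn0 : (0 : ℝ) < n := by exact_mod_cast hn
  have e1 : Real.exp (-(8 * Real.log (n / δ))) = (δ / n) ^ 8 := by
    rw [← mul_neg, ← Real.log_inv, inv_div, mul_comm, show (8 : ℝ) = (8 : ℕ) by norm_num,
      mul_comm, Real.exp_nat_mul, Real.exp_log (by positivity)]
  have h1 : δ / n ≤ 1 / 2 := by
    rw [div_le_div_iff₀ hn0 two_pos]; linarith
  have h2 : (δ / n) ^ 6 ≤ (1 / 2) ^ 6 := pow_le_pow_left₀ (by positivity) h1 6
  rw [e1]
  calc 10 * (n : ℝ) ^ 2 * (δ / n) ^ 8 = 10 * δ ^ 2 * (δ / n) ^ 6 := by field_simp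
    _ ≤ 10 * δ ^ 2 * (1 / 2) ^ 6 := by gcongr
    _ ≤ δ / 2 := by nlinarith

end Width

end WeightNorm
end

/-! ### Assembly of the main theorem. -/

theorem mainTheorem1 :
    ∃ c₀ : ℝ, 0 < c₀ ∧ ∀ M K : ℝ, ∃ C : ℝ, 0 < C ∧
      ∀ (n d m : ℕ) (α δ : ℝ) (x : Fin n → WeightNorm.Vec d) (y : EuclideanSpace ℝ (Fin n)),
        50 ≤ d → 0 < α → α ≤ 1 → 0 < δ → δ < 1 → 2 * δ ≤ (n : ℝ) →
        (∀ i, ‖x i‖ ≤ 1) → (∀ i, x i ≠ 0) →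
        (∀ i j, i ≠ j → ∀ β : ℝ, β ≠ 0 → x i ≠ β • x j) →
        (∀ i, |y i| ≤ M) →
        ((m : ℝ) / δ) ^ ((1 : ℝ) / (d : ℝ)) ≤ K * (m : ℝ) ^ ((1 : ℝ) / 5) →
        C * ((n : ℝ) ^ 4 * Real.log ((n : ℝ) / δ) /
          WeightNorm.lambdaMin (WeightNorm.gramVInf α x) ^ 4) ≤ (m : ℝ) →
        ∃ E : Set (Fin m → WeightNorm.Vec d × ℝ), MeasurableSet E ∧
          ENNReal.ofReal (1 - δ) ≤ WeightNorm.initLaw m d α E ∧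
          ∀ ω ∈ E, ∀ η : ℝ, 0 < η →
            η ≤ c₀ * (α ^ 2 / WeightNorm.specNorm (WeightNorm.gramVInf α x)) →
            (∀ s : ℕ, WeightNorm.lambdaMin (WeightNorm.gramVInf α x) / (2 * α ^ 2) ≤
              WeightNorm.lambdaMin (WeightNorm.evolution α (fun k => (ω k).2) x
                (WeightNorm.gdIter (fun k => (ω k).2) x y η (WeightNorm.initParams α ω) s))) ∧
            (∀ s : ℕ,
              ‖WeightNorm.pred (fun k => (ω k).2) x
                (WeightNorm.gdIter (fun k => (ω k).2) x y η (WeightNorm.initParams α ω) s) - y‖ ^ 2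
              ≤ (1 - η * WeightNorm.lambdaMin (WeightNorm.gramVInf α x) / (2 * α ^ 2)) ^ s *
                ‖WeightNorm.pred (fun k => (ω k).2) x (WeightNorm.initParams α ω) - y‖ ^ 2) := by
  open WeightNorm in
  -- With `S = ‖V^∞‖`, the evolution matrix is at most `S + T + λ₀`, where `T ≤ 8 S + λ₀ / 100` and
  -- `λ₀ ≤ S`; this is below `11 S`.
  refine ⟨1 / 11, by norm_num, fun M K => ?_⟩
  -- Initial residuals are at most `4 √L + |M|` in each entry, and `4 (4 √L + |M|) ≤ D √L` because
  -- `√L ≥ 1/2`.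
  set D : ℝ := 8 * |M| + 16 with hD
  have hD1 : 1 ≤ D := by rw [hD]; linarith [abs_nonneg M]
  refine ⟨640000 * D ^ 4 * (1 + |K| ^ 5), by positivity, ?_⟩
  intro n d m α δ x y hd hα hα1 hδ hδ1 hδn hx hx0 hpar hy hK hm
  have hn : 0 < n := by
    rcases Nat.eq_zero_or_pos n with rfl | h
    · simp at hδn; linarith
    · exact h
  have hn0 : (0 : ℝ) < n := by exact_mod_cast hn
  set lam := lambdaMin (gramVInf α x) with hlamdef
  set S := specNorm (gramVInf α x) with hSdef
  set L := Real.log ((n : ℝ) / δ) with hL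
  have hlam : 0 < lam := lambdaMin_gramVInf_pos (by omega) hn hα x hx hx0 hpar
  have hlam1 : lam ≤ 1 := lambdaMin_gramVInf_le_one hn hα x hx
  have hlamS : lam ≤ S := lambdaMin_le_specNorm hn (gramVInf_symm x)
  have hS : 0 < S := hlam.trans_le hlamS
  -- The hypothesis `2 δ ≤ n` gives `n / δ ≥ 2`; it is automatic for `n ≥ 2`, means `δ ≤ 1/2` for `n
  -- = 1`, and excludes `n = 0`.
  have hL2 : 1 / 2 ≤ L := by
    have h1 : Real.log 2 ≤ L := Real.log_le_log two_pos (by rw [le_div_iff₀ hδ]; linarith)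
    linarith [Real.log_two_gt_d9]
  have hL0 : 0 < L := by linarith
  have hsL : 1 / 2 ≤ √L := Real.le_sqrt_of_sq_le (by linarith)
  obtain ⟨hm0, hRτ, hq, hball⟩ :=
    width_bounds hn (by omega) hlam hlam1 hδ hδ1 hL hL2 hD1 rfl hK hm
  have hmR : (0 : ℝ) < m := by exact_mod_cast hm0
  set R : ℝ := D * n * √L / (√(m : ℝ) * lam) with hR
  set τ : ℝ := lam / (100 * n) with hτ
  have hsm : 0 < √(m : ℝ) := Real.sqrt_pos.2 hmR
  have hR0 : 0 < R := by positivity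
  have hτ0 : 0 < τ := by positivity
  have hnτ : 100 * (n * τ) = lam := by rw [hτ]; field_simp
  set T : ℝ := (∑ i, ‖x i‖ ^ 2) / d + n * τ with hT
  have hT0 : 0 ≤ T := by positivity
  have hTS : T ≤ 8 * S + lam / 100 := by
    have h1 := sum_norm_sq_le_specNorm (by omega : 2 ≤ d) hα x hx hx0
    have hd0 : (0 : ℝ) < d := by exact_mod_cast (by omega : 0 < d)
    have h2 : (∑ i, ‖x i‖ ^ 2) / d ≤ 8 * S := by
      rw [div_le_iff₀ hd0]; linarith
    rw [hT]; linarith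
  -- The threshold `u = 4 √L` for the initial predictions satisfies `u² / 2 = 8 L`, the exponent
  -- used for all other events.
  have hprob := baseLaw_not_good_le (by omega : 3 ≤ d) hm0 hn hα x hx hx0 hR0 hRτ
    (by positivity : 0 ≤ 4 * √L) hq
    (by rw [mul_pow, Real.sq_sqrt hL0.le]; linarith : 8 * L ≤ (4 * √L) ^ 2 / 2)
  have hprob' := hprob.trans (ENNReal.ofReal_le_ofReal
    (by linarith [ten_mul_sq_mul_exp_le hn hδ hδ1 hδn] :
      _ ≤ δ))
  obtain ⟨E, hE, hEprob, hEω⟩ := exists_event_of_baseLaw hα _ hprob' hδ.le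
  refine ⟨E, hE, hEprob, fun ω hω η hη hηle => ?_⟩
  obtain ⟨ω₀, ⟨hgood, hpred⟩, rfl⟩ := hEω ω hω
  set c : Fin m → ℝ := fun k => (ω₀ k).2
  set w₀ : Fin m → Vec d := fun k => (ω₀ k).1
  set θ₀ : Params m d := ⟨w₀, fun k => ‖w₀ k‖⟩ with hθ₀
  have hinit : initParams α (fun k => (α • (ω₀ k).1, (ω₀ k).2)) = θ₀.scale α := by
    simp only [initParams, Params.scale, hθ₀, norm_smul, Real.norm_of_nonneg hα.le, w₀,
      mul_div_cancel_left₀ _ hα.ne']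
  rw [hinit]
  set h := η / α ^ 2 with hh
  have hh0 : 0 < h := by positivity
  have hhS : h * (11 * S) ≤ 1 := by
    have h1 : h ≤ 1 / (11 * S) := by
      rw [hh, div_le_iff₀ (by positivity)]
      refine hηle.trans (le_of_eq ?_)
      field_simp
    rwa [le_div_iff₀ (by positivity)] at h1
  have hstep : h * (S + T + lam) ≤ 1 := by
    refine le_trans ?_ hhS
    gcongr
    linarith
  have hres : 4 * (√(n : ℝ) * ‖pred c x θ₀ - y‖) ≤ R * (√(m : ℝ) * lam) := by
    have h1 : ∀ i, |(pred c x θ₀ - y) i| ≤ 4 * √L + |M| := fun i => by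
      refine (abs_sub _ _).trans (add_le_add (hpred i) ((hy i).trans (le_abs_self M)))
    have h2 := norm_le_sqrt_mul_of_forall_abs_le (by positivity) h1
    have h3 : R * (√(m : ℝ) * lam) = D * n * √L := by rw [hR]; field_simp
    rw [h3]
    calc 4 * (√(n : ℝ) * ‖pred c x θ₀ - y‖) ≤ 4 * (√(n : ℝ) * (√(n : ℝ) * (4 * √L + |M|))) := by
          gcongr
      _ = 4 * (n * (4 * √L + |M|)) := by
          rw [← mul_assoc (√(n : ℝ)), Real.mul_self_sqrt hn0.le]
      _ ≤ D * n * √L := by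
          have h4 : 0 ≤ n * |M| * (√L - 1 / 2) :=
            mul_nonneg (by positivity) (by linarith)
          rw [hD]
          linarith
  have main := hgood.descent (y := y) (h := h) (β := α ^ 2) hnτ.le hτ0.le hlam hlamS hT0 hh0
    (by positivity) (pow_le_one₀ hα.le hα1) (fun a => lambdaMin_mul_le (gramVInf_symm x) a)
    (fun a => inner_op_le_specNorm _ a) hstep hres
  change (∀ s, _ ≤ lambdaMin (evolution α c x (gdIter c x y η (θ₀.scale α) s))) ∧
    ∀ s, ‖pred c x (gdIter c x y η (θ₀.scale α) s) - y‖ ^ 2 ≤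
      _ * ‖pred c x (θ₀.scale α) - y‖ ^ 2
  refine ⟨fun s => ?_, fun s => ?_⟩
  · rw [gdIter_scale hα, evolution_scale hα]
    refine le_lambdaMin hn (fun i j => ?_) fun a => ?_
    · simp only [Matrix.smul_apply, Matrix.add_apply]
      rw [gramV_symm, gramG_symm]
    · rw [inner_op_smul]
      have h1 := hgood.le_evolution (main s).1 hnτ.le hτ0.le (sq_nonneg α)
        (fun a => lambdaMin_mul_le (gramVInf_symm x) a) a
      calc lam / (2 * α ^ 2) * ‖a‖ ^ 2 = 1 / α ^ 2 * (1 / 2 * lam * ‖a‖ ^ 2) := by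
            field_simp
        _ ≤ 1 / α ^ 2 * (22 / 25 * lam * ‖a‖ ^ 2) := by
            gcongr ?_ * (?_ * _ * _)
            norm_num
        _ ≤ _ := by gcongr
  · rw [gdIter_scale hα, pred_scale hα, pred_scale hα]
    have hq : 1 - η * lam / (2 * α ^ 2) = 1 - h * lam / 2 := by rw [hh]; field_simp
    rw [hq]
    have hhl : h * lam ≤ 1 :=
      (mul_le_mul_of_nonneg_left (by linarith) hh0.le).trans hhS
    have hhl0 : 0 < h * lam := mul_pos hh0 hlam
    have hq0 : 0 ≤ 1 - h * lam / 2 := by linarith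
    have hq1 : 1 - h * lam / 2 ≤ 1 := by linarith
    -- Squaring yields the exponent `2 s`; one of the two factors is bounded by `1`, which is all
    -- the stated rate requires.
    calc _ ≤ ((1 - h * lam / 2) ^ s * ‖pred c x θ₀ - y‖) ^ 2 :=
          pow_le_pow_left₀ (norm_nonneg _) (main s).2 2
      _ = (1 - h * lam / 2) ^ s * (1 - h * lam / 2) ^ s * ‖pred c x θ₀ - y‖ ^ 2 := by ring
      _ ≤ (1 - h * lam / 2) ^ s * 1 * ‖pred c x θ₀ - y‖ ^ 2 := by
          gcongr
          exact pow_le_one₀ hq0 hq1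
      _ = _ := by ring
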